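/- All operads are non-symmetric, and an operad in $CAT$ consists of small categories $\mathcal O_m$ ($m\ge 0$), an identity object $id\in\mathcal O_1$ and composition functors $\gamma:\mathcal O_m\times\prod_{i=1}^m\mathcal O_{k_i}\to\mathcal O_{k_1+\dots+k_m}$ that are strictly unital and associative; a map of such operads is a family of functors strictly preserving $id$ and $\gamma$. The associahedral operad $\mathfrak K$: $\mathfrak K_m$ is the poset of parenthesized words on $W_m=\{x_1<\dots<x_m\}$, i.e. of sets $P$ of closed intervals of $W_m$, each with at least $2$ and fewer than $m$ elements, any two of which are nested or disjoint; $P_2\le P_1$ iff $P_1\subseteq P_2$ (so morphisms drop parentheses). Composition substitutes the $i$-th word (with its own outer parentheses) for the $i$-th letter; equivalently, it grafts the corresponding planar trees, and nodes left with at most one input, which can happen when an empty word is substituted, are removed. The LaPlaza operad $\mathcal L$: a directed monoidal category is a category with a bifunctor $\Box$, an object $0$ that is a strict two-sided unit for $\Box$, and a natural transformation (not necessarily invertible) $\eta_{A,B,C}:(A\Box B)\Box C\to A\Box(B\Box C)$ that is the identity whenever one of $A,B,C$ is $0$ and that satisfies the pentagon identity $\eta_{A,B,C\Box D}\circ\eta_{A\Box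 B,C,D}=(id_A\Box\eta_{B,C,D})\circ\eta_{A,B\Box C,D}\circ(\eta_{A,B,C}\Box id_D)$. $\mathcal L_m$ is the full subcategory of the free directed monoidal category on $x_1,\dots,x_m$ on the objects that become $x_1\Box x_2\Box\dots\Box x_m$ after removing all parentheses (the object $0$ if $m=0$), and composition is substitution. Theorem. There is a map of $CAT$-operads $\Lambda:\mathfrak K\to\mathcal L$ that is a surjection, in the following sense: for every $m\ge 0$ the functor $\Lambda_m:\mathfrak K_m\to\mathcal L_m$ is surjective on objects, and every morphism of $\mathcal L_m$ is a finite composite of morphisms in the image of $\Lambda_m$. Moreover $\Lambda$ sends the morphism $(x_1x_2)x_3\to x_1x_2x_3$ of $\mathfrak K_3$ to $\eta_{x_1,x_2,x_3}:(x_1\Box x_2)\Box x_3\to x_1\Box(x_2\Box x_3)$. -/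

import Mathlib

open CategoryTheory

/-! ### Blocks -/

/-- Cut `{0, …, n - 1}` into `m` consecutive blocks of sizes `k 0, …, k (m - 1)`:
`blockEquiv k h ⟨i, j⟩` is the `j`-th element of the `i`-th block. -/
def blockEquiv {m n : ℕ} (k : Fin m → ℕ) (h : ∑ i, k i = n) : (Σ i, Fin (k i)) ≃ Fin n :=
  finSigmaFinEquiv.trans (finCongr h)

theorem blockEquiv_val {m n : ℕ} (k : Fin m → ℕ) (h : ∑ i, k i = n) (i : Fin m)
    (j : Fin (k i)) : (blockEquiv k h ⟨i, j⟩ : ℕ) = ∑ x ∈ Finset.Iio i, k x + j := by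
  have e : ∑ x : Fin i, k (Fin.castLE i.2.le x) = ∑ x ∈ Finset.Iio i, k x := by
    refine Finset.sum_bij (fun x _ => Fin.castLE i.2.le x) ?_ ?_ ?_ ?_
    · intro a _
      simp [Fin.lt_def]
    · intro a _ b _ hab
      simpa [Fin.ext_iff] using hab
    · intro b hb
      exact ⟨⟨b, Fin.lt_def.mp (Finset.mem_Iio.mp hb)⟩, Finset.mem_univ _, rfl⟩
    · intro a _
      rfl
  rw [← e, blockEquiv, Equiv.trans_apply, finCongr_apply, Fin.val_cast, finSigmaFinEquiv_apply]

theorem blockEquiv_lt_of_fst {m n : ℕ} (k : Fin m → ℕ) (h : ∑ i, k i = n) {i i' : Fin m}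
    (hi : i < i') (j : Fin (k i)) (j' : Fin (k i')) :
    blockEquiv k h ⟨i, j⟩ < blockEquiv k h ⟨i', j'⟩ := by
  rw [Fin.lt_def, blockEquiv_val, blockEquiv_val]
  have h1 : ∑ x ∈ insert i (Finset.Iio i), k x ≤ ∑ x ∈ Finset.Iio i', k x := by
    refine Finset.sum_le_sum_of_subset ?_
    intro x hx
    simp only [Finset.mem_insert, Finset.mem_Iio] at hx ⊢
    rcases hx with rfl | hx
    · exact hi
    · exact hx.trans hi
  rw [Finset.sum_insert (by simp)] at h1
  have := j.2
  omega

theorem blockEquiv_lt_of_snd {m n : ℕ} (k : Fin m → ℕ) (h : ∑ i, k i = n) {i : Fin m}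
    {j j' : Fin (k i)} (hj : j < j') :
    blockEquiv k h ⟨i, j⟩ < blockEquiv k h ⟨i, j'⟩ := by
  rw [Fin.lt_def, blockEquiv_val, blockEquiv_val]
  rw [Fin.lt_def] at hj
  omega

theorem blockEquiv_lt_iff {m n : ℕ} (k : Fin m → ℕ) (h : ∑ i, k i = n)
    (s t : Σ i, Fin (k i)) :
    blockEquiv k h s < blockEquiv k h t ↔ Sigma.Lex (· < ·) (fun _ => (· < ·)) s t := by
  have key : ∀ s t : Σ i, Fin (k i), Sigma.Lex (· < ·) (fun _ => (· < ·)) s t →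
      blockEquiv k h s < blockEquiv k h t := by
    rintro s t (⟨_, _, hi⟩ | ⟨_, _, hj⟩)
    · exact blockEquiv_lt_of_fst k h hi _ _
    · exact blockEquiv_lt_of_snd k h hj
  refine ⟨fun hlt => ?_, key s t⟩
  rcases trichotomous_of (Sigma.Lex (· < ·) (fun _ => (· < ·))) s t with h1 | h1 | h1
  · exact h1
  · exact absurd hlt (by simp [h1])
  · exact absurd hlt (key _ _ h1).not_gt

theorem sum_blockEquiv {m n p : ℕ} (k : Fin m → ℕ) (h : ∑ i, k i = n) (l : Fin n → ℕ)
    (h' : ∑ j, l j = p) : ∑ i, ∑ j, l (blockEquiv k h ⟨i, j⟩) = p := by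
  rw [← h', ← Equiv.sum_comp (blockEquiv k h) l, Fintype.sum_sigma]

/-- Cutting into blocks and then cutting the blocks is the same as cutting in one step. -/
theorem blockEquiv_assoc {m n p : ℕ} (k : Fin m → ℕ) (h : ∑ i, k i = n) (l : Fin n → ℕ)
    (h' : ∑ j, l j = p) (i : Fin m) (j : Fin (k i)) (x : Fin (l (blockEquiv k h ⟨i, j⟩))) :
    blockEquiv (fun i => ∑ j, l (blockEquiv k h ⟨i, j⟩)) (sum_blockEquiv k h l h')
        ⟨i, blockEquiv (fun j => l (blockEquiv k h ⟨i, j⟩)) rfl ⟨j, x⟩⟩ =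
      blockEquiv l h' ⟨blockEquiv k h ⟨i, j⟩, x⟩ := by
  let F : (Σ y, Fin (l y)) → Fin p := fun t =>
    blockEquiv (fun i => ∑ j, l (blockEquiv k h ⟨i, j⟩)) (sum_blockEquiv k h l h')
      ⟨((blockEquiv k h).symm t.1).1,
        blockEquiv (fun j => l (blockEquiv k h ⟨((blockEquiv k h).symm t.1).1, j⟩)) rfl
          ⟨((blockEquiv k h).symm t.1).2, Fin.cast (by simp) t.2⟩⟩
  have hF : ∀ (i : Fin m) (j : Fin (k i)) (x : Fin (l (blockEquiv k h ⟨i, j⟩))),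
      F ⟨blockEquiv k h ⟨i, j⟩, x⟩ =
        blockEquiv (fun i => ∑ j, l (blockEquiv k h ⟨i, j⟩)) (sum_blockEquiv k h l h')
          ⟨i, blockEquiv (fun j => l (blockEquiv k h ⟨i, j⟩)) rfl ⟨j, x⟩⟩ := by
    intro i j x
    have aux : ∀ (s : Σ i, Fin (k i)) (hs : s = ⟨i, j⟩)
        (hx : l (blockEquiv k h ⟨i, j⟩) = l (blockEquiv k h ⟨s.1, s.2⟩)),
        blockEquiv (fun i => ∑ j, l (blockEquiv k h ⟨i, j⟩)) (sum_blockEquiv k h l h')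
          ⟨s.1, blockEquiv (fun j => l (blockEquiv k h ⟨s.1, j⟩)) rfl
            ⟨s.2, Fin.cast hx x⟩⟩ =
        blockEquiv (fun i => ∑ j, l (blockEquiv k h ⟨i, j⟩)) (sum_blockEquiv k h l h')
          ⟨i, blockEquiv (fun j => l (blockEquiv k h ⟨i, j⟩)) rfl ⟨j, x⟩⟩ := by
      rintro _ rfl _
      rfl
    exact aux _ (by simp) _
  rw [← hF]
  have hmono : StrictMono (fun y => F ((blockEquiv l h').symm y)) := by
    intro y y' hy
    obtain ⟨⟨a, x⟩, rfl⟩ := (blockEquiv l h').surjective y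
    obtain ⟨⟨a', x'⟩, rfl⟩ := (blockEquiv l h').surjective y'
    rw [blockEquiv_lt_iff] at hy
    simp only [Equiv.symm_apply_apply]
    obtain ⟨⟨i, j⟩, rfl⟩ := (blockEquiv k h).surjective a
    rcases hy with ⟨_, _, ha⟩ | ⟨_, _, hx⟩
    · obtain ⟨⟨i', j'⟩, rfl⟩ := (blockEquiv k h).surjective a'
      rw [blockEquiv_lt_iff] at ha
      rw [hF, hF]
      rcases ha with ⟨_, _, hi⟩ | ⟨_, _, hj⟩
      · exact blockEquiv_lt_of_fst _ _ hi _ _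
      · exact blockEquiv_lt_of_snd _ _ (blockEquiv_lt_of_fst _ _ hj _ _)
    · rw [hF, hF]
      exact blockEquiv_lt_of_snd _ _ (blockEquiv_lt_of_snd _ _ hx)
  have hid : (fun y => F ((blockEquiv l h').symm y)) = id := by
    have := Subsingleton.elim (hmono.orderIsoOfSurjective _
      (Finite.surjective_of_injective hmono.injective)) (OrderIso.refl _)
    exact congrArg (fun e : Fin p ≃o Fin p => (e : Fin p → Fin p)) this
  simpa using congrFun hid (blockEquiv l h' ⟨blockEquiv k h ⟨i, j⟩, x⟩)

theorem blockEquiv_one {n : ℕ} (h : ∑ _ : Fin 1, n = n) (i : Fin 1) (j : Fin n) :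
    blockEquiv (fun _ : Fin 1 => n) h ⟨i, j⟩ = j := by
  apply Fin.ext
  rw [blockEquiv_val, Subsingleton.elim i 0]
  simp

theorem blockEquiv_ones {n : ℕ} (h : ∑ _ : Fin n, 1 = n) (i : Fin n) (j : Fin 1) :
    blockEquiv (fun _ : Fin n => 1) h ⟨i, j⟩ = i := by
  apply Fin.ext
  rw [blockEquiv_val, Subsingleton.elim j 0]
  simp

/-! ### Operads in `CAT` -/

/-- A (non-symmetric) operad in the category of small categories.  The composition functor
`γ : O(m) × O(k₁) × ⋯ × O(k_m) ⥤ O(k₁ + ⋯ + k_m)` is indexed by an arbitrary `n` with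
`k₁ + ⋯ + k_m = n`, so that the unit and associativity laws need no transport. -/
structure CatOperad where
  /-- The category of `m`-ary operations. -/
  Op : ℕ → Type
  [cat : ∀ m, SmallCategory (Op m)]
  /-- The identity operation. -/
  one : Op 1
  /-- Operadic composition. -/
  γ {m n : ℕ} (k : Fin m → ℕ) (h : ∑ i, k i = n) : Op m × (∀ i, Op (k i)) ⥤ Op n
  one_γ_obj {n : ℕ} (h : ∑ _ : Fin 1, n = n) (T : Op n) :
    (γ (fun _ : Fin 1 => n) h).obj (one, fun _ => T) = T
  one_γ_map {n : ℕ} (h : ∑ _ : Fin 1, n = n) {T T' : Op n} (f : T ⟶ T') :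
    HEq ((γ (fun _ : Fin 1 => n) h).map (X := (one, fun _ => T)) (Y := (one, fun _ => T'))
      (𝟙 one, fun _ => f)) f
  γ_one_obj {n : ℕ} (h : ∑ _ : Fin n, 1 = n) (T : Op n) :
    (γ (fun _ : Fin n => 1) h).obj (T, fun _ => one) = T
  γ_one_map {n : ℕ} (h : ∑ _ : Fin n, 1 = n) {T T' : Op n} (f : T ⟶ T') :
    HEq ((γ (fun _ : Fin n => 1) h).map (X := (T, fun _ => one)) (Y := (T', fun _ => one))
      (f, fun _ => 𝟙 one)) f
  γ_assoc_obj {m n p : ℕ} (k : Fin m → ℕ) (h : ∑ i, k i = n) (l : Fin n → ℕ)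
    (h' : ∑ j, l j = p) (S : Op m) (T : ∀ i, Op (k i)) (U : ∀ j, Op (l j)) :
    (γ l h').obj ((γ k h).obj (S, T), U) =
      (γ (fun i => ∑ j, l (blockEquiv k h ⟨i, j⟩)) (sum_blockEquiv k h l h')).obj
        (S, fun i => (γ (fun j => l (blockEquiv k h ⟨i, j⟩)) rfl).obj
          (T i, fun j => U (blockEquiv k h ⟨i, j⟩)))
  γ_assoc_map {m n p : ℕ} (k : Fin m → ℕ) (h : ∑ i, k i = n) (l : Fin n → ℕ)
    (h' : ∑ j, l j = p) {S S' : Op m} {T T' : ∀ i, Op (k i)} {U U' : ∀ j, Op (l j)}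
    (f : S ⟶ S') (g : ∀ i, T i ⟶ T' i) (e : ∀ j, U j ⟶ U' j) :
    HEq
      ((γ l h').map (X := ((γ k h).obj (S, T), U)) (Y := ((γ k h).obj (S', T'), U'))
        ((γ k h).map (X := (S, T)) (Y := (S', T')) (f, g), e))
      ((γ (fun i => ∑ j, l (blockEquiv k h ⟨i, j⟩)) (sum_blockEquiv k h l h')).map
        (X := (S, fun i => (γ (fun j => l (blockEquiv k h ⟨i, j⟩)) rfl).obj
          (T i, fun j => U (blockEquiv k h ⟨i, j⟩))))
        (Y := (S', fun i => (γ (fun j => l (blockEquiv k h ⟨i, j⟩)) rfl).obj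
          (T' i, fun j => U' (blockEquiv k h ⟨i, j⟩))))
        (f, fun i => (γ (fun j => l (blockEquiv k h ⟨i, j⟩)) rfl).map
          (X := (T i, fun j => U (blockEquiv k h ⟨i, j⟩)))
          (Y := (T' i, fun j => U' (blockEquiv k h ⟨i, j⟩)))
          (g i, fun j => e (blockEquiv k h ⟨i, j⟩))))

attribute [instance] CatOperad.cat

/-- A map of operads in `CAT`: functors between the categories of `m`-ary operations that
strictly preserve the identity operation and the composition functors. -/
structure CatOperad.Hom (O O' : CatOperad) where
  /-- The functor on `m`-ary operations. -/
  app (m : ℕ) : O.Op m ⥤ O'.Op m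
  app_one : (app 1).obj O.one = O'.one
  app_γ_obj {m n : ℕ} (k : Fin m → ℕ) (h : ∑ i, k i = n) (S : O.Op m)
    (T : ∀ i, O.Op (k i)) :
    (app n).obj ((O.γ k h).obj (S, T)) =
      (O'.γ k h).obj ((app m).obj S, fun i => (app (k i)).obj (T i))
  app_γ_map {m n : ℕ} (k : Fin m → ℕ) (h : ∑ i, k i = n) {S S' : O.Op m}
    {T T' : ∀ i, O.Op (k i)} (f : S ⟶ S') (g : ∀ i, T i ⟶ T' i) :
    HEq ((app n).map ((O.γ k h).map (X := (S, T)) (Y := (S', T')) (f, g)))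
      ((O'.γ k h).map (X := ((app m).obj S, fun i => (app (k i)).obj (T i)))
        (Y := ((app m).obj S', fun i => (app (k i)).obj (T' i)))
        ((app m).map f, fun i => (app (k i)).map (g i)))

/-- A map of operads in `CAT` is a surjection if, in every arity, it is surjective on objects
and every morphism of the target is a finite composite of morphisms in the image. -/
def CatOperad.Hom.IsSurjection {O O' : CatOperad} (F : O.Hom O') : Prop :=
  ∀ m, Function.Surjective (F.app m).obj ∧
    ((⊤ : MorphismProperty (O.Op m)).strictMap (F.app m)).multiplicativeClosure = ⊤

/-! ### The associahedral operad -/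

/-- A parenthesized word on the linear order `x₁ < ⋯ < x_m`: a collection of closed intervals,
each having at least two elements and different from the whole word, any two of which are
nested or disjoint. -/
@[ext]
structure ParenWord (m : ℕ) where
  /-- The pairs of matching parentheses. -/
  parens : Set (Set (Fin m))
  isInterval : ∀ p ∈ parens, ∃ a b, p = Set.Icc a b
  nontrivial : ∀ p ∈ parens, p.Nontrivial
  ne_univ : ∀ p ∈ parens, p ≠ Set.univ
  nested : ∀ p ∈ parens, ∀ q ∈ parens, p ⊆ q ∨ q ⊆ p ∨ Disjoint p q

namespace ParenWord

/-- `(W, P₂) ≤ (W, P₁)` iff `P₁ ⊆ P₂`: morphisms drop parentheses. -/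
instance (m : ℕ) : PartialOrder (ParenWord m) where
  le S T := T.parens ⊆ S.parens
  le_refl S := Set.Subset.rfl
  le_trans _ _ _ h h' := Set.Subset.trans h' h
  le_antisymm S T h h' := ParenWord.ext (Set.Subset.antisymm h' h)

/-- The string `x₁x₂⋯x_m` without parentheses. -/
def bare (m : ℕ) : ParenWord m where
  parens := ∅
  isInterval := by simp
  nontrivial := by simp
  ne_univ := by simp
  nested := by simp

/-- The index of the block that contains a given letter. -/
def blockIndex {m n : ℕ} (k : Fin m → ℕ) (h : ∑ i, k i = n) (y : Fin n) : Fin m :=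
  ((blockEquiv k h).symm y).1

@[simp]
theorem blockIndex_blockEquiv {m n : ℕ} (k : Fin m → ℕ) (h : ∑ i, k i = n) (i : Fin m)
    (j : Fin (k i)) : blockIndex k h (blockEquiv k h ⟨i, j⟩) = i := by
  simp [blockIndex]

theorem blockIndex_mono {m n : ℕ} (k : Fin m → ℕ) (h : ∑ i, k i = n) :
    Monotone (blockIndex k h) := by
  intro y y' hy
  obtain ⟨⟨i, j⟩, rfl⟩ := (blockEquiv k h).surjective y
  obtain ⟨⟨i', j'⟩, rfl⟩ := (blockEquiv k h).surjective y'
  rw [blockIndex_blockEquiv, blockIndex_blockEquiv]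
  by_contra hlt
  exact absurd hy (blockEquiv_lt_of_fst k h (not_le.mp hlt) _ _).not_ge

theorem blockEquiv_strictMono {m n : ℕ} (k : Fin m → ℕ) (h : ∑ i, k i = n) (i : Fin m) :
    StrictMono (fun j => blockEquiv k h ⟨i, j⟩) :=
  fun _ _ hj => blockEquiv_lt_of_snd k h hj

theorem exists_eq_Icc {n : ℕ} {p : Set (Fin n)} (hp : p.Nontrivial) (ho : p.OrdConnected) :
    ∃ a b, p = Set.Icc a b := by
  obtain ⟨a, ha, ha'⟩ := Set.exists_min_image p id p.toFinite hp.nonempty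
  obtain ⟨b, hb, hb'⟩ := Set.exists_max_image p id p.toFinite hp.nonempty
  exact ⟨a, b, Set.Subset.antisymm (fun x hx => ⟨ha' x hx, hb' x hx⟩) (ho.out ha hb)⟩

/-- The sets of letters that lie over the nodes of the tree obtained by grafting the trees
`T i` onto the leaves of the tree `S`, before degenerate nodes are removed: a node of `S`
contributes the union of the blocks over it, a node of `T i` contributes its copy in the
`i`-th block.  (The root node contributes the whole word.) -/
def graft {m n : ℕ} (k : Fin m → ℕ) (h : ∑ i, k i = n) (S : ParenWord m)
    (T : ∀ i, ParenWord (k i)) : Set (Set (Fin n)) :=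
  {I | (∃ p, (p ∈ S.parens ∨ p = Set.univ) ∧ I = blockIndex k h ⁻¹' p) ∨
    ∃ i, ∃ q, (q ∈ (T i).parens ∨ q = Set.univ) ∧
      I = (fun j => blockEquiv k h ⟨i, j⟩) '' q}

theorem graft_ordConnected {m n : ℕ} {k : Fin m → ℕ} {h : ∑ i, k i = n} {S : ParenWord m}
    {T : ∀ i, ParenWord (k i)} {I : Set (Fin n)} (hI : I ∈ graft k h S T) :
    I.OrdConnected := by
  rcases hI with ⟨p, hp, rfl⟩ | ⟨i, q, hq, rfl⟩
  · have ho : p.OrdConnected := by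
      rcases hp with hp | rfl
      · obtain ⟨a, b, rfl⟩ := S.isInterval p hp
        exact Set.ordConnected_Icc
      · exact Set.ordConnected_univ
    exact ho.preimage_mono (blockIndex_mono k h)
  · have ho : q.OrdConnected := by
      rcases hq with hq | rfl
      · obtain ⟨a, b, rfl⟩ := (T i).isInterval q hq
        exact Set.ordConnected_Icc
      · exact Set.ordConnected_univ
    refine ⟨?_⟩
    rintro _ ⟨x, hx, rfl⟩ _ ⟨y, hy, rfl⟩ z ⟨hz, hz'⟩
    obtain ⟨⟨i', j⟩, rfl⟩ := (blockEquiv k h).surjective z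
    have h1 := blockIndex_mono k h hz
    have h2 := blockIndex_mono k h hz'
    simp only [blockIndex_blockEquiv] at h1 h2
    obtain rfl := le_antisymm h1 h2
    exact ⟨j, ho.out hx hy ⟨(blockEquiv_strictMono k h _).le_iff_le.mp hz,
      (blockEquiv_strictMono k h _).le_iff_le.mp hz'⟩, rfl⟩

theorem nested_or {m : ℕ} (S : ParenWord m) {p q : Set (Fin m)}
    (hp : p ∈ S.parens ∨ p = Set.univ) (hq : q ∈ S.parens ∨ q = Set.univ) :
    p ⊆ q ∨ q ⊆ p ∨ Disjoint p q := by
  rcases hp with hp | rfl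
  · rcases hq with hq | rfl
    · exact S.nested p hp q hq
    · exact Or.inl (Set.subset_univ _)
  · exact Or.inr (Or.inl (Set.subset_univ _))

theorem graft_nested_aux {m n : ℕ} {k : Fin m → ℕ} {h : ∑ i, k i = n} (p : Set (Fin m))
    (i : Fin m) (q : Set (Fin (k i))) :
    (fun j => blockEquiv k h ⟨i, j⟩) '' q ⊆ blockIndex k h ⁻¹' p ∨
      Disjoint ((fun j => blockEquiv k h ⟨i, j⟩) '' q) (blockIndex k h ⁻¹' p) := by
  by_cases hi : i ∈ p
  · left
    rintro _ ⟨x, _, rfl⟩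
    simpa using hi
  · right
    rw [Set.disjoint_left]
    rintro _ ⟨x, _, rfl⟩
    simpa using hi

theorem graft_nested {m n : ℕ} {k : Fin m → ℕ} {h : ∑ i, k i = n} {S : ParenWord m}
    {T : ∀ i, ParenWord (k i)} {I J : Set (Fin n)} (hI : I ∈ graft k h S T)
    (hJ : J ∈ graft k h S T) : I ⊆ J ∨ J ⊆ I ∨ Disjoint I J := by
  rcases hI with ⟨p, hp, rfl⟩ | ⟨i, q, hq, rfl⟩
  · rcases hJ with ⟨p', hp', rfl⟩ | ⟨i, q, hq, rfl⟩
    · rcases S.nested_or hp hp' with h1 | h1 | h1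
      · exact Or.inl (Set.preimage_mono h1)
      · exact Or.inr (Or.inl (Set.preimage_mono h1))
      · exact Or.inr (Or.inr (h1.preimage _))
    · rcases graft_nested_aux (h := h) p i q with h1 | h1
      · exact Or.inr (Or.inl h1)
      · exact Or.inr (Or.inr h1.symm)
  · rcases hJ with ⟨p', hp', rfl⟩ | ⟨i', q', hq', rfl⟩
    · rcases graft_nested_aux (h := h) p' i q with h1 | h1
      · exact Or.inl h1
      · exact Or.inr (Or.inr h1)
    · by_cases hi : i = i'
      · subst hi
        rcases (T i).nested_or hq hq' with h1 | h1 | h1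
        · exact Or.inl (Set.image_mono h1)
        · exact Or.inr (Or.inl (Set.image_mono h1))
        · exact Or.inr (Or.inr
            (Set.disjoint_image_iff (blockEquiv_strictMono k h i).injective |>.mpr h1))
      · right
        right
        rw [Set.disjoint_left]
        rintro _ ⟨x, _, rfl⟩ ⟨y, _, hxy⟩
        have := congrArg (blockIndex k h) hxy
        simp only [blockIndex_blockEquiv] at this
        exact hi this.symm

/-- Operadic composition of parenthesized words: substitute `T i` for the `i`-th letter of
`S`.  Nodes that are left without input or with a single input, which is possible if some
`T i` is the empty word, disappear. -/
def subst {m n : ℕ} (k : Fin m → ℕ) (h : ∑ i, k i = n) (S : ParenWord m)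
    (T : ∀ i, ParenWord (k i)) : ParenWord n where
  parens := {I | I ∈ graft k h S T ∧ I.Nontrivial ∧ I ≠ Set.univ}
  isInterval _ hI := exists_eq_Icc hI.2.1 (graft_ordConnected hI.1)
  nontrivial _ hI := hI.2.1
  ne_univ _ hI := hI.2.2
  nested _ hI _ hJ := graft_nested hI.1 hJ.1

theorem subst_mono {m n : ℕ} (k : Fin m → ℕ) (h : ∑ i, k i = n) {S S' : ParenWord m}
    {T T' : ∀ i, ParenWord (k i)} (hS : S ≤ S') (hT : ∀ i, T i ≤ T' i) :
    subst k h S T ≤ subst k h S' T' := by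
  rintro I ⟨hI, h'⟩
  refine ⟨?_, h'⟩
  rcases hI with ⟨p, hp, rfl⟩ | ⟨i, q, hq, rfl⟩
  · exact Or.inl ⟨p, hp.imp_left (fun x => hS x), rfl⟩
  · exact Or.inr ⟨i, q, hq.imp_left (fun x => hT i x), rfl⟩

/-- All parentheses, including the trivial ones. -/
def full {m : ℕ} (S : ParenWord m) : Set (Set (Fin m)) :=
  {I | I ∈ S.parens ∨ I = Set.univ ∨ I.Subsingleton}

theorem full_injective {m : ℕ} {S T : ParenWord m} (h : S.full = T.full) : S = T := by
  have key : ∀ {S T : ParenWord m}, S.full = T.full → S.parens ⊆ T.parens := by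
    intro S T h I hI
    have h1 : I ∈ T.full := h ▸ Or.inl hI
    rcases h1 with h1 | h1 | h1
    · exact h1
    · exact absurd h1 (S.ne_univ I hI)
    · exact absurd h1 (Set.not_subsingleton_iff.mpr (S.nontrivial I hI))
  exact ParenWord.ext (Set.Subset.antisymm (key h) (key h.symm))

theorem mem_full_subst {m n : ℕ} {k : Fin m → ℕ} {h : ∑ i, k i = n} {S : ParenWord m}
    {T : ∀ i, ParenWord (k i)} {I : Set (Fin n)} :
    I ∈ (subst k h S T).full ↔ (∃ p ∈ S.full, I = blockIndex k h ⁻¹' p) ∨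
      ∃ i, ∃ q ∈ (T i).full, I = (fun j => blockEquiv k h ⟨i, j⟩) '' q := by
  have of_graft : ∀ J ∈ graft k h S T, J ∈ (subst k h S T).full := by
    intro J hJ
    by_cases h1 : J.Nontrivial
    · by_cases h2 : J = Set.univ
      · exact Or.inr (Or.inl h2)
      · exact Or.inl ⟨hJ, h1, h2⟩
    · exact Or.inr (Or.inr (Set.not_nontrivial_iff.mp h1))
  constructor
  · rintro (⟨hI | hI, _⟩ | rfl | hI)
    · obtain ⟨p, hp, rfl⟩ := hI
      exact Or.inl ⟨p, hp.imp_right Or.inl, rfl⟩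
    · obtain ⟨i, q, hq, rfl⟩ := hI
      exact Or.inr ⟨i, q, hq.imp_right Or.inl, rfl⟩
    · exact Or.inl ⟨Set.univ, Or.inr (Or.inl rfl), rfl⟩
    · rcases hI.eq_empty_or_singleton with rfl | ⟨y, rfl⟩
      · exact Or.inl ⟨∅, Or.inr (Or.inr Set.subsingleton_empty), rfl⟩
      · obtain ⟨⟨i, j⟩, rfl⟩ := (blockEquiv k h).surjective y
        exact Or.inr ⟨i, {j}, Or.inr (Or.inr Set.subsingleton_singleton), by simp⟩
  · rintro (⟨p, hp | rfl | hp, rfl⟩ | ⟨i, q, hq | rfl | hq, rfl⟩)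
    · exact of_graft _ (Or.inl ⟨p, Or.inl hp, rfl⟩)
    · exact Or.inr (Or.inl rfl)
    · rcases hp.eq_empty_or_singleton with rfl | ⟨i, rfl⟩
      · exact Or.inr (Or.inr (by simp))
      · refine of_graft _ (Or.inr ⟨i, Set.univ, Or.inr rfl, ?_⟩)
        ext y
        obtain ⟨⟨i', j⟩, rfl⟩ := (blockEquiv k h).surjective y
        simp only [Set.mem_preimage, blockIndex_blockEquiv, Set.mem_singleton_iff,
          Set.image_univ, Set.mem_range]
        constructor
        · rintro rfl
          exact ⟨j, rfl⟩
        · rintro ⟨x, hx⟩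
          have := congrArg (blockIndex k h) hx
          simpa using this.symm
    · exact of_graft _ (Or.inr ⟨i, q, Or.inl hq, rfl⟩)
    · exact of_graft _ (Or.inr ⟨i, Set.univ, Or.inr rfl, rfl⟩)
    · exact Or.inr (Or.inr (hq.image _))

theorem subst_assoc {m n p : ℕ} (k : Fin m → ℕ) (h : ∑ i, k i = n) (l : Fin n → ℕ)
    (h' : ∑ j, l j = p) (S : ParenWord m) (T : ∀ i, ParenWord (k i))
    (U : ∀ j, ParenWord (l j)) :
    subst l h' (subst k h S T) U =
      subst (fun i => ∑ j, l (blockEquiv k h ⟨i, j⟩)) (sum_blockEquiv k h l h') S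
        (fun i => subst (fun j => l (blockEquiv k h ⟨i, j⟩)) rfl (T i)
          (fun j => U (blockEquiv k h ⟨i, j⟩))) := by
  have hidx : ∀ q : Set (Fin m), blockIndex l h' ⁻¹' (blockIndex k h ⁻¹' q) =
      blockIndex (fun i => ∑ j, l (blockEquiv k h ⟨i, j⟩)) (sum_blockEquiv k h l h') ⁻¹' q := by
    intro q
    ext y
    obtain ⟨⟨a, x⟩, rfl⟩ := (blockEquiv l h').surjective y
    obtain ⟨⟨i, j⟩, rfl⟩ := (blockEquiv k h).surjective a
    rw [← blockEquiv_assoc]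
    simp only [Set.mem_preimage, blockIndex_blockEquiv]
    rw [blockEquiv_assoc k h l h']
    simp
  have hmid : ∀ (i : Fin m) (q : Set (Fin (k i))),
      blockIndex l h' ⁻¹' ((fun j => blockEquiv k h ⟨i, j⟩) '' q) =
        (fun y => blockEquiv (fun i => ∑ j, l (blockEquiv k h ⟨i, j⟩))
            (sum_blockEquiv k h l h') ⟨i, y⟩) ''
          (blockIndex (fun j => l (blockEquiv k h ⟨i, j⟩)) rfl ⁻¹' q) := by
    intro i q
    ext y
    constructor
    · obtain ⟨⟨a, x⟩, rfl⟩ := (blockEquiv l h').surjective y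
      rintro ⟨j, hj, hja⟩
      simp only [blockIndex_blockEquiv] at hja
      subst hja
      exact ⟨blockEquiv (fun j => l (blockEquiv k h ⟨i, j⟩)) rfl ⟨j, x⟩, by simpa using hj,
        blockEquiv_assoc k h l h' i j x⟩
    · rintro ⟨z, hz, rfl⟩
      obtain ⟨⟨j, x⟩, rfl⟩ :=
        (blockEquiv (fun j => l (blockEquiv k h ⟨i, j⟩)) rfl).surjective z
      refine ⟨j, by simpa using hz, ?_⟩
      dsimp only
      rw [blockEquiv_assoc k h l h', blockIndex_blockEquiv]
  have htop : ∀ (i : Fin m) (j : Fin (k i)) (r : Set (Fin (l (blockEquiv k h ⟨i, j⟩)))),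
      (fun x => blockEquiv l h' ⟨blockEquiv k h ⟨i, j⟩, x⟩) '' r =
        (fun y => blockEquiv (fun i => ∑ j, l (blockEquiv k h ⟨i, j⟩))
            (sum_blockEquiv k h l h') ⟨i, y⟩) ''
          ((fun x => blockEquiv (fun j => l (blockEquiv k h ⟨i, j⟩)) rfl ⟨j, x⟩) '' r) := by
    intro i j r
    rw [Set.image_image]
    exact Set.image_congr fun x _ => (blockEquiv_assoc k h l h' i j x).symm
  apply full_injective
  ext I
  rw [mem_full_subst, mem_full_subst]
  constructor
  · rintro (⟨J, hJ, rfl⟩ | ⟨a, r, hr, rfl⟩)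
    · rw [mem_full_subst] at hJ
      rcases hJ with ⟨q, hq, rfl⟩ | ⟨i, q, hq, rfl⟩
      · exact Or.inl ⟨q, hq, hidx q⟩
      · exact Or.inr ⟨i, _, mem_full_subst.mpr (Or.inl ⟨q, hq, rfl⟩), hmid i q⟩
    · obtain ⟨⟨i, j⟩, rfl⟩ := (blockEquiv k h).surjective a
      exact Or.inr ⟨i, _, mem_full_subst.mpr (Or.inr ⟨j, r, hr, rfl⟩), htop i j r⟩
  · rintro (⟨q, hq, rfl⟩ | ⟨i, J, hJ, rfl⟩)
    · exact Or.inl ⟨_, mem_full_subst.mpr (Or.inl ⟨q, hq, rfl⟩), (hidx q).symm⟩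
    · rw [mem_full_subst] at hJ
      rcases hJ with ⟨q, hq, rfl⟩ | ⟨j, r, hr, rfl⟩
      · exact Or.inl ⟨_, mem_full_subst.mpr (Or.inr ⟨i, q, hq, rfl⟩), (hmid i q).symm⟩
      · exact Or.inr ⟨_, r, hr, (htop i j r).symm⟩

theorem bare_subst {n : ℕ} (h : ∑ _ : Fin 1, n = n) (T : ParenWord n) :
    subst (fun _ : Fin 1 => n) h (bare 1) (fun _ => T) = T := by
  apply full_injective
  ext I
  rw [mem_full_subst]
  constructor
  · rintro (⟨p, _, rfl⟩ | ⟨i, q, hq, rfl⟩)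
    · rcases Set.eq_empty_or_nonempty p with rfl | ⟨a, ha⟩
      · exact Or.inr (Or.inr (by simp))
      · refine Or.inr (Or.inl (Set.eq_univ_of_forall fun y => ?_))
        rw [Set.mem_preimage, Subsingleton.elim (blockIndex _ h y) a]
        exact ha
    · simpa [blockEquiv_one] using hq
  · intro hI
    exact Or.inr ⟨0, I, hI, by simp [blockEquiv_one]⟩

theorem subst_bare {n : ℕ} (h : ∑ _ : Fin n, 1 = n) (T : ParenWord n) :
    subst (fun _ : Fin n => 1) h T (fun _ => bare 1) = T := by
  have hb : blockIndex (fun _ : Fin n => 1) h = id := by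
    funext y
    have := blockIndex_blockEquiv (fun _ : Fin n => 1) h y 0
    rwa [blockEquiv_ones] at this
  apply full_injective
  ext I
  rw [mem_full_subst, hb]
  constructor
  · rintro (⟨p, hp, rfl⟩ | ⟨i, q, _, rfl⟩)
    · exact hp
    · exact Or.inr (Or.inr (Set.subsingleton_of_subsingleton.image _))
  · intro hI
    exact Or.inl ⟨I, hI, rfl⟩

end ParenWord

/-- The associahedral operad: its category of `m`-ary operations is the poset of
parenthesized words of length `m`, its composition is substitution of words. -/
def associahedralOperad : CatOperad where
  Op := ParenWord
  one := ParenWord.bare 1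
  γ k h :=
    { obj := fun X => ParenWord.subst k h X.1 X.2
      map := fun f => homOfLE (ParenWord.subst_mono k h (leOfHom f.1) (fun i => leOfHom (f.2 i))) }
  one_γ_obj h T := ParenWord.bare_subst h T
  one_γ_map h T T' f := by
    refine Subsingleton.helim ?_ _ _
    dsimp only
    rw [ParenWord.bare_subst, ParenWord.bare_subst]
  γ_one_obj h T := ParenWord.subst_bare h T
  γ_one_map h T T' f := by
    refine Subsingleton.helim ?_ _ _
    dsimp only
    rw [ParenWord.subst_bare, ParenWord.subst_bare]
  γ_assoc_obj k h l h' S T U := ParenWord.subst_assoc k h l h' S T U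
  γ_assoc_map k h l h' S S' T T' U U' f g e := by
    refine Subsingleton.helim ?_ _ _
    dsimp only
    rw [ParenWord.subst_assoc, ParenWord.subst_assoc]

/-! ### Directed monoidal categories -/

universe u v w u₂ v₂

/-- A directed monoidal category with a strict unit: a bifunctor `□`, an object `0` which is a
strict unit for `□`, and a natural transformation `η : (A □ B) □ C ⟶ A □ (B □ C)`, not
necessarily invertible, which is the identity whenever one of `A`, `B`, `C` is `0` and which
satisfies the pentagon identity. -/
class DirectedMonoidal (C : Type u) [Category.{v} C] where
  /-- The bifunctor `□` on objects. -/
  tensorObj : C → C → C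
  /-- The bifunctor `□` on morphisms. -/
  tensorHom {A A' B B' : C} (f : A ⟶ A') (g : B ⟶ B') : tensorObj A B ⟶ tensorObj A' B'
  tensor_id (A B : C) : tensorHom (𝟙 A) (𝟙 B) = 𝟙 (tensorObj A B)
  tensor_comp {A A' A'' B B' B'' : C} (f : A ⟶ A') (f' : A' ⟶ A'') (g : B ⟶ B')
    (g' : B' ⟶ B'') : tensorHom (f ≫ f') (g ≫ g') = tensorHom f g ≫ tensorHom f' g'
  /-- The strict unit. -/
  zero : C
  zero_tensorObj (A : C) : tensorObj zero A = A
  tensorObj_zero (A : C) : tensorObj A zero = A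
  zero_tensorHom {A B : C} (f : A ⟶ B) : HEq (tensorHom (𝟙 zero) f) f
  tensorHom_zero {A B : C} (f : A ⟶ B) : HEq (tensorHom f (𝟙 zero)) f
  /-- The associativity natural transformation. -/
  η (A B D : C) : tensorObj (tensorObj A B) D ⟶ tensorObj A (tensorObj B D)
  η_naturality {A A' B B' D D' : C} (f : A ⟶ A') (g : B ⟶ B') (h : D ⟶ D') :
    tensorHom (tensorHom f g) h ≫ η A' B' D' = η A B D ≫ tensorHom f (tensorHom g h)
  η_zero_left (B D : C) : HEq (η zero B D) (𝟙 (tensorObj B D))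
  η_zero_mid (A D : C) : HEq (η A zero D) (𝟙 (tensorObj A D))
  η_zero_right (A B : C) : HEq (η A B zero) (𝟙 (tensorObj A B))
  pentagon (A B D E : C) :
    η (tensorObj A B) D E ≫ η A B (tensorObj D E) =
      tensorHom (η A B D) (𝟙 E) ≫ η A (tensorObj B D) E ≫ tensorHom (𝟙 A) (η B D E)

section

open DirectedMonoidal

/-! ### The free directed monoidal category -/

/-- Formal morphisms between planar binary trees with leaves labelled in `X` (that is,
nonempty parenthesized `□`-products of generators). -/
inductive TreeTerm {X : Type u} : FreeMagma X → FreeMagma X → Type u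
  | id (a) : TreeTerm a a
  | comp {a b c} (f : TreeTerm a b) (g : TreeTerm b c) : TreeTerm a c
  | tensor {a a' b b'} (f : TreeTerm a a') (g : TreeTerm b b') :
      TreeTerm (.mul a b) (.mul a' b')
  | η (a b c) : TreeTerm (.mul (.mul a b) c) (.mul a (.mul b c))

open TreeTerm in
/-- The congruence on formal morphisms generated by the axioms of a category, the
bifunctoriality of `□`, the naturality of `η` and the pentagon identity. -/
inductive TreeRel {X : Type u} : ∀ {a b : FreeMagma X}, TreeTerm a b → TreeTerm a b → Prop
  | refl {a b} (f : TreeTerm a b) : TreeRel f f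
  | symm {a b} {f g : TreeTerm a b} : TreeRel f g → TreeRel g f
  | trans {a b} {f g h : TreeTerm a b} : TreeRel f g → TreeRel g h → TreeRel f h
  | comp_congr {a b c} {f f' : TreeTerm a b} {g g' : TreeTerm b c} :
      TreeRel f f' → TreeRel g g' → TreeRel (comp f g) (comp f' g')
  | tensor_congr {a a' b b'} {f f' : TreeTerm a a'} {g g' : TreeTerm b b'} :
      TreeRel f f' → TreeRel g g' → TreeRel (tensor f g) (tensor f' g')
  | id_comp {a b} (f : TreeTerm a b) : TreeRel (comp (.id a) f) f
  | comp_id {a b} (f : TreeTerm a b) : TreeRel (comp f (.id b)) f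
  | assoc {a b c d} (f : TreeTerm a b) (g : TreeTerm b c) (h : TreeTerm c d) :
      TreeRel (comp (comp f g) h) (comp f (comp g h))
  | tensor_id (a b) : TreeRel (tensor (.id a) (.id b)) (.id (.mul a b))
  | tensor_comp {a a' a'' b b' b''} (f : TreeTerm a a') (f' : TreeTerm a' a'')
      (g : TreeTerm b b') (g' : TreeTerm b' b'') :
      TreeRel (tensor (comp f f') (comp g g')) (comp (tensor f g) (tensor f' g'))
  | η_naturality {a a' b b' c c'} (f : TreeTerm a a') (g : TreeTerm b b')
      (h : TreeTerm c c') :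
      TreeRel (comp (tensor (tensor f g) h) (η a' b' c'))
        (comp (η a b c) (tensor f (tensor g h)))
  | pentagon (a b c d) :
      TreeRel (comp (η (.mul a b) c d) (η a b (.mul c d)))
        (comp (tensor (η a b c) (.id d)) (comp (η a (.mul b c) d) (tensor (.id a) (η b c d))))

/-- Formal morphisms up to the congruence. -/
def treeSetoid {X : Type u} (a b : FreeMagma X) : Setoid (TreeTerm a b) :=
  ⟨TreeRel, TreeRel.refl, TreeRel.symm, TreeRel.trans⟩

/-- Morphisms between nonempty parenthesized products in the free directed monoidal
category. -/
def TreeHom {X : Type u} (a b : FreeMagma X) : Type u := Quotient (treeSetoid a b)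

namespace TreeHom

variable {X : Type u}

/-- The class of a formal morphism. -/
def mk {a b : FreeMagma X} (f : TreeTerm a b) : TreeHom a b := Quotient.mk (treeSetoid a b) f

theorem sound {a b : FreeMagma X} {f g : TreeTerm a b} (h : TreeRel f g) : mk f = mk g :=
  Quotient.sound (s := treeSetoid a b) h

theorem ind {a b : FreeMagma X} {P : TreeHom a b → Prop} (h : ∀ f, P (mk f)) (f) : P f :=
  Quotient.ind (s := treeSetoid a b) h f

/-- Composition of morphisms between trees. -/
def comp {a b c : FreeMagma X} : TreeHom a b → TreeHom b c → TreeHom a c :=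
  Quotient.map₂ (sa := treeSetoid a b) (sb := treeSetoid b c) (sc := treeSetoid a c)
    TreeTerm.comp (fun _ _ h _ _ h' => TreeRel.comp_congr h h')

/-- The product `□` of morphisms between trees. -/
def tensor {a a' b b' : FreeMagma X} :
    TreeHom a a' → TreeHom b b' → TreeHom (.mul a b) (.mul a' b') :=
  Quotient.map₂ (sa := treeSetoid a a') (sb := treeSetoid b b')
    (sc := treeSetoid (.mul a b) (.mul a' b'))
    TreeTerm.tensor (fun _ _ h _ _ h' => TreeRel.tensor_congr h h')

theorem mk_comp {a b c : FreeMagma X} (f : TreeTerm a b) (g : TreeTerm b c) :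
    mk (f.comp g) = (mk f).comp (mk g) := rfl

theorem mk_tensor {a a' b b' : FreeMagma X} (f : TreeTerm a a') (g : TreeTerm b b') :
    mk (f.tensor g) = (mk f).tensor (mk g) := rfl

theorem id_comp {a b : FreeMagma X} (f : TreeHom a b) : (mk (.id a)).comp f = f :=
  ind (P := fun f => (mk (.id a)).comp f = f) (fun f => sound (.id_comp f)) f

theorem comp_id {a b : FreeMagma X} (f : TreeHom a b) : f.comp (mk (.id b)) = f :=
  ind (P := fun f => f.comp (mk (.id b)) = f) (fun f => sound (.comp_id f)) f

theorem tensor_id (a b : FreeMagma X) :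
    (mk (.id a)).tensor (mk (.id b)) = mk (.id (.mul a b)) := sound (.tensor_id a b)

end TreeHom

/-- The objects of the free directed monoidal category with strict unit on a set `X`: the
unit `0`, and the planar binary trees with leaves labelled in `X`. -/
inductive FreeDirected (X : Type u) : Type u
  | zero : FreeDirected X
  | tree (t : FreeMagma X) : FreeDirected X

namespace FreeDirected

variable {X : Type u}

/-- A generating object. -/
def of (x : X) : FreeDirected X := tree (.of x)

/-- The morphisms of the free directed monoidal category: as `0` is a strict unit and `η` is
the identity whenever one of its arguments is `0`, the unit contributes only its own
identity. -/
inductive Hom : FreeDirected X → FreeDirected X → Type u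
  | idZero : Hom zero zero
  | tree {s t : FreeMagma X} (f : TreeHom s t) : Hom (tree s) (tree t)

/-- Identities. -/
def Hom.id : ∀ A : FreeDirected X, Hom A A
  | zero => idZero
  | .tree t => .tree (.mk (.id t))

/-- Composition. -/
def Hom.comp : ∀ {A B D : FreeDirected X}, Hom A B → Hom B D → Hom A D
  | _, _, _, idZero, idZero => idZero
  | _, _, _, .tree f, .tree g => .tree (f.comp g)

instance : Category.{u} (FreeDirected X) where
  Hom := Hom
  id := Hom.id
  comp := Hom.comp
  id_comp := by
    rintro _ _ (_ | ⟨⟨f⟩⟩)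
    · rfl
    · exact congrArg Hom.tree (TreeHom.sound (.id_comp f))
  comp_id := by
    rintro _ _ (_ | ⟨⟨f⟩⟩)
    · rfl
    · exact congrArg Hom.tree (TreeHom.sound (.comp_id f))
  assoc := by
    rintro _ _ _ _ (_ | ⟨⟨f⟩⟩) (_ | ⟨⟨g⟩⟩) (_ | ⟨⟨h⟩⟩)
    · rfl
    · exact congrArg Hom.tree (TreeHom.sound (.assoc f g h))

/-- The product `□` of objects. -/
def tensorO : FreeDirected X → FreeDirected X → FreeDirected X
  | zero, B => B
  | tree a, zero => tree a
  | tree a, tree b => tree (.mul a b)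

/-- The product `□` of morphisms. -/
def tensorH : ∀ {A A' B B' : FreeDirected X}, Hom A A' → Hom B B' →
    Hom (tensorO A B) (tensorO A' B')
  | _, _, _, _, .idZero, g => g
  | _, _, _, _, .tree f, .idZero => .tree f
  | _, _, _, _, .tree f, .tree g => .tree (f.tensor g)

/-- The associativity transformation. -/
def etaH : ∀ A B D : FreeDirected X,
    Hom (tensorO (tensorO A B) D) (tensorO A (tensorO B D))
  | zero, B, D => Hom.id (tensorO B D)
  | tree a, zero, D => Hom.id (tensorO (tree a) D)
  | tree a, tree b, zero => Hom.id (tree (.mul a b))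
  | tree a, tree b, tree d => .tree (.mk (.η a b d))

theorem nat_aux {A B : FreeDirected X} (f : Hom A B) :
    Hom.comp f (Hom.id B) = Hom.comp (Hom.id A) f :=
  (Category.comp_id (X := A) (Y := B) f).trans (Category.id_comp (X := A) (Y := B) f).symm

instance : DirectedMonoidal (FreeDirected X) where
  tensorObj := tensorO
  tensorHom := tensorH
  tensor_id := by
    rintro (_ | a) (_ | b)
    · rfl
    · rfl
    · rfl
    · exact congrArg Hom.tree (TreeHom.sound (.tensor_id a b))
  tensor_comp := by
    rintro _ _ _ _ _ _ (_ | ⟨⟨f⟩⟩) (_ | ⟨⟨f'⟩⟩) (_ | ⟨⟨g⟩⟩) (_ | ⟨⟨g'⟩⟩)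
    · rfl
    · rfl
    · rfl
    · exact congrArg Hom.tree (TreeHom.sound (.tensor_comp f f' g g'))
  zero := zero
  zero_tensorObj _ := rfl
  tensorObj_zero := by rintro (_ | a) <;> rfl
  zero_tensorHom _ := HEq.rfl
  tensorHom_zero := by rintro _ _ (_ | f) <;> exact HEq.rfl
  η := etaH
  η_naturality := by
    rintro _ _ _ _ _ _ (_ | ⟨⟨f⟩⟩) (_ | ⟨⟨g⟩⟩) (_ | ⟨⟨h⟩⟩)
    · rfl
    · exact nat_aux (.tree _)
    · exact nat_aux (.tree _)
    · exact nat_aux (.tree _)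
    · exact nat_aux (.tree _)
    · exact nat_aux (.tree _)
    · exact nat_aux (.tree _)
    · exact congrArg Hom.tree (TreeHom.sound (.η_naturality f g h))
  η_zero_left _ _ := HEq.rfl
  η_zero_mid := by rintro (_ | a) _ <;> exact HEq.rfl
  η_zero_right := by rintro (_ | a) (_ | b) <;> exact HEq.rfl
  pentagon := by
    rintro (_ | a) (_ | b) (_ | d) (_ | e)
    all_goals try rfl
    all_goals refine congrArg Hom.tree (?_ : TreeHom.mk (.comp _ _) = TreeHom.mk (.comp _ (.comp _ _)))
    all_goals try
      simp only [TreeHom.mk_comp, TreeHom.mk_tensor, TreeHom.id_comp, TreeHom.comp_id,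
        TreeHom.tensor_id]
    exact TreeHom.sound (.pentagon _ _ _ _)

end FreeDirected

namespace FreeDirected

/-! #### Evaluation in a directed monoidal category -/

theorem heq_comp {C : Type u} [Category.{v} C] {A A' B B' D D' : C} (hA : A = A')
    (hB : B = B') (hD : D = D')
    {f : A ⟶ B} {f' : A' ⟶ B'} {g : B ⟶ D} {g' : B' ⟶ D'} (hf : HEq f f') (hg : HEq g g') :
    HEq (f ≫ g) (f' ≫ g') := by
  subst hA hB hD hf hg
  rfl

section Evaluation

variable {X : Type w} {C : Type u} [Category.{v} C] [DirectedMonoidal C]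

/-- The value of a tree, once its leaves have been given values in a directed monoidal
category. -/
def evalTree (c : X → C) : FreeMagma X → C
  | .of x => c x
  | .mul a b => tensorObj (evalTree c a) (evalTree c b)

/-- The value of a formal morphism. -/
def evalFormal (c : X → C) : ∀ {a b : FreeMagma X}, TreeTerm a b →
    (evalTree c a ⟶ evalTree c b)
  | _, _, .id a => 𝟙 (evalTree c a)
  | _, _, .comp f g => evalFormal c f ≫ evalFormal c g
  | _, _, .tensor f g => tensorHom (evalFormal c f) (evalFormal c g)
  | _, _, .η a b d => η (evalTree c a) (evalTree c b) (evalTree c d)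

theorem evalFormal_rel (c : X → C) {a b : FreeMagma X} {f g : TreeTerm a b}
    (h : TreeRel f g) : evalFormal c f = evalFormal c g := by
  induction h with
  | refl => rfl
  | symm _ ih => exact ih.symm
  | trans _ _ ih ih' => exact ih.trans ih'
  | comp_congr _ _ ih ih' => simp only [evalFormal, ih, ih']
  | tensor_congr _ _ ih ih' => exact congrArg₂ tensorHom ih ih'
  | id_comp f => exact Category.id_comp _
  | comp_id f => exact Category.comp_id _
  | assoc f g h => exact Category.assoc _ _ _
  | tensor_id a b => exact DirectedMonoidal.tensor_id _ _
  | tensor_comp f f' g g' => exact DirectedMonoidal.tensor_comp _ _ _ _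
  | η_naturality f g h => exact DirectedMonoidal.η_naturality _ _ _
  | pentagon a b d e => exact DirectedMonoidal.pentagon _ _ _ _

/-- The value of a morphism between trees. -/
def evalTreeHom (c : X → C) {a b : FreeMagma X} : TreeHom a b →
    (evalTree c a ⟶ evalTree c b) :=
  Quotient.lift (s := treeSetoid a b) (evalFormal c) (fun _ _ h => evalFormal_rel c h)

/-- The value of a tree depends functorially on the values of the leaves. -/
def evalTreeNat {c c' : X → C} (g : ∀ x, c x ⟶ c' x) :
    ∀ t : FreeMagma X, evalTree c t ⟶ evalTree c' t
  | .of x => g x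
  | .mul a b => tensorHom (evalTreeNat g a) (evalTreeNat g b)

theorem evalFormal_naturality {c c' : X → C} (g : ∀ x, c x ⟶ c' x) {a b : FreeMagma X}
    (f : TreeTerm a b) :
    evalFormal c f ≫ evalTreeNat g b = evalTreeNat g a ≫ evalFormal c' f := by
  induction f with
  | id a => exact (Category.id_comp _).trans (Category.comp_id _).symm
  | comp f f' ih ih' => simp only [evalFormal, Category.assoc, ih', reassoc_of% ih]
  | tensor f f' ih ih' =>
    exact (DirectedMonoidal.tensor_comp _ _ _ _).symm.trans
      ((congrArg₂ tensorHom ih ih').trans (DirectedMonoidal.tensor_comp _ _ _ _))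
  | η a b d => exact (DirectedMonoidal.η_naturality _ _ _).symm

theorem evalTreeNat_id (c : X → C) (t : FreeMagma X) :
    evalTreeNat (fun x => 𝟙 (c x)) t = 𝟙 (evalTree c t) := by
  induction t with
  | ih1 x => rfl
  | ih2 a b iha ihb =>
    exact (congrArg₂ tensorHom iha ihb).trans (DirectedMonoidal.tensor_id _ _)

theorem evalTreeNat_comp {c c' c'' : X → C} (g : ∀ x, c x ⟶ c' x) (g' : ∀ x, c' x ⟶ c'' x)
    (t : FreeMagma X) :
    evalTreeNat (fun x => g x ≫ g' x) t = evalTreeNat g t ≫ evalTreeNat g' t := by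
  induction t with
  | ih1 x => rfl
  | ih2 a b iha ihb =>
    exact (congrArg₂ tensorHom iha ihb).trans (DirectedMonoidal.tensor_comp _ _ _ _)

/-- The value of an object of the free directed monoidal category, once the generators have
been given values. -/
def evalObj (c : X → C) : FreeDirected X → C
  | zero => DirectedMonoidal.zero
  | tree t => evalTree c t

/-- The value of a morphism of the free directed monoidal category. -/
def evalMap (c : X → C) : ∀ {A B : FreeDirected X}, (A ⟶ B) → (evalObj c A ⟶ evalObj c B)
  | _, _, .idZero => 𝟙 DirectedMonoidal.zero
  | _, _, .tree f => evalTreeHom c f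

/-- The value of an object depends functorially on the values of the generators. -/
def evalNat {c c' : X → C} (g : ∀ x, c x ⟶ c' x) :
    ∀ A : FreeDirected X, evalObj c A ⟶ evalObj c' A
  | zero => 𝟙 DirectedMonoidal.zero
  | tree t => evalTreeNat g t

theorem evalMap_id (c : X → C) (A : FreeDirected X) : evalMap c (𝟙 A) = 𝟙 (evalObj c A) := by
  cases A <;> rfl

theorem evalMap_comp (c : X → C) {A B D : FreeDirected X} (f : A ⟶ B) (g : B ⟶ D) :
    evalMap c (f ≫ g) = evalMap c f ≫ evalMap c g := by
  rcases f with _ | ⟨⟨f⟩⟩ <;> rcases g with _ | ⟨⟨g⟩⟩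
  · exact (Category.id_comp _).symm
  · rfl

theorem evalMap_naturality {c c' : X → C} (g : ∀ x, c x ⟶ c' x) {A B : FreeDirected X}
    (f : A ⟶ B) : evalMap c f ≫ evalNat g B = evalNat g A ≫ evalMap c' f := by
  rcases f with _ | ⟨⟨f⟩⟩
  · rfl
  · exact evalFormal_naturality g f

theorem evalNat_id (c : X → C) (A : FreeDirected X) :
    evalNat (fun x => 𝟙 (c x)) A = 𝟙 (evalObj c A) := by
  cases A
  · rfl
  · exact evalTreeNat_id c _

theorem evalNat_comp {c c' c'' : X → C} (g : ∀ x, c x ⟶ c' x) (g' : ∀ x, c' x ⟶ c'' x)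
    (A : FreeDirected X) :
    evalNat (fun x => g x ≫ g' x) A = evalNat g A ≫ evalNat g' A := by
  cases A
  · exact (Category.id_comp _).symm
  · exact evalTreeNat_comp g g' _

/-- Evaluation of a morphism at a family of morphisms. -/
def act {A A' : FreeDirected X} {c c' : X → C} (f : A ⟶ A') (g : ∀ x, c x ⟶ c' x) :
    evalObj c A ⟶ evalObj c' A' :=
  evalMap c f ≫ evalNat g A'

theorem act_id (A : FreeDirected X) (c : X → C) :
    act (𝟙 A) (fun x => 𝟙 (c x)) = 𝟙 (evalObj c A) := by
  rw [act, evalMap_id, evalNat_id, Category.comp_id]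

theorem act_comp {A A' A'' : FreeDirected X} {c c' c'' : X → C} (f : A ⟶ A') (f' : A' ⟶ A'')
    (g : ∀ x, c x ⟶ c' x) (g' : ∀ x, c' x ⟶ c'' x) :
    act (f ≫ f') (fun x => g x ≫ g' x) = act f g ≫ act f' g' := by
  simp only [act, evalMap_comp, evalNat_comp, Category.assoc]
  rw [← Category.assoc (evalMap c f'), evalMap_naturality, Category.assoc]

/-! #### Evaluation is strict -/

theorem heq_tensor {A A' B B' D D' E E' : C} (hA : A = A') (hB : B = B') (hD : D = D')
    (hE : E = E') {f : A ⟶ B} {f' : A' ⟶ B'} {g : D ⟶ E} {g' : D' ⟶ E'} (hf : HEq f f')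
    (hg : HEq g g') : HEq (tensorHom f g) (tensorHom f' g') := by
  subst hA hB hD hE hf hg
  rfl

theorem evalObj_tensor (c : X → C) (A B : FreeDirected X) :
    evalObj c (tensorObj A B) = tensorObj (evalObj c A) (evalObj c B) := by
  rcases A with _ | a
  · exact (zero_tensorObj _).symm
  · rcases B with _ | b
    · exact (tensorObj_zero _).symm
    · rfl

theorem evalMap_tensor (c : X → C) {A A' B B' : FreeDirected X} (f : A ⟶ A') (g : B ⟶ B') :
    HEq (evalMap c (tensorHom f g)) (tensorHom (evalMap c f) (evalMap c g)) := by
  rcases f with _ | ⟨⟨f⟩⟩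
  · exact (zero_tensorHom _).symm
  · rcases g with _ | ⟨⟨g⟩⟩
    · exact (tensorHom_zero _).symm
    · rfl

theorem evalNat_tensor {c c' : X → C} (g : ∀ x, c x ⟶ c' x) (A B : FreeDirected X) :
    HEq (evalNat g (tensorObj A B)) (tensorHom (evalNat g A) (evalNat g B)) := by
  rcases A with _ | a
  · exact (zero_tensorHom _).symm
  · rcases B with _ | b
    · exact (tensorHom_zero _).symm
    · rfl

theorem evalMap_η (c : X → C) (A B D : FreeDirected X) :
    HEq (evalMap c (η A B D)) (η (evalObj c A) (evalObj c B) (evalObj c D)) := by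
  rcases A with _ | a
  · refine (heq_of_eq (evalMap_id c (tensorObj B D))).trans ?_
    rw [evalObj_tensor]
    exact (η_zero_left _ _).symm
  · rcases B with _ | b
    · refine (heq_of_eq (evalMap_id c (tensorObj (tree a) D))).trans ?_
      rw [evalObj_tensor]
      exact (η_zero_mid _ _).symm
    · rcases D with _ | d
      · exact (heq_of_eq (evalMap_id c (tree (.mul a b)))).trans (η_zero_right _ _).symm
      · rfl

end Evaluation

/-! #### The universal property -/

/-- A functor between directed monoidal categories that strictly preserves `□`, `0` and `η`. -/
structure IsStrict {C : Type u} [Category.{v} C] [DirectedMonoidal C] {D : Type u₂}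
    [Category.{v₂} D] [DirectedMonoidal D] (F : C ⥤ D) : Prop where
  obj_zero : F.obj DirectedMonoidal.zero = DirectedMonoidal.zero
  obj_tensor (A B : C) : F.obj (tensorObj A B) = tensorObj (F.obj A) (F.obj B)
  map_tensor {A A' B B' : C} (f : A ⟶ A') (g : B ⟶ B') :
    HEq (F.map (tensorHom f g)) (tensorHom (F.map f) (F.map g))
  map_η (A B E : C) : HEq (F.map (η A B E)) (η (F.obj A) (F.obj B) (F.obj E))

/-- The strict functor that extends a given assignment on generators. -/
def lift {X : Type w} {C : Type u} [Category.{v} C] [DirectedMonoidal C] (c : X → C) :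
    FreeDirected X ⥤ C where
  obj := evalObj c
  map := evalMap c
  map_id := evalMap_id c
  map_comp := evalMap_comp c

/-- `FreeDirected X` is the free directed monoidal category on `X`. -/
theorem lift_unique {X : Type w} {C : Type u} [Category.{v} C] [DirectedMonoidal C]
    (c : X → C) : ∃! F : FreeDirected X ⥤ C, IsStrict F ∧ ∀ x, F.obj (of x) = c x := by
  refine ⟨lift c, ⟨⟨rfl, evalObj_tensor c, evalMap_tensor c, evalMap_η c⟩, fun _ => rfl⟩, ?_⟩
  rintro F ⟨hF, hc⟩
  have htree : ∀ t : FreeMagma X, F.obj (tree t) = evalTree c t := by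
    intro t
    induction t with
    | ih1 x => exact hc x
    | ih2 a b iha ihb =>
      exact (hF.obj_tensor (tree a) (tree b)).trans (congrArg₂ tensorObj iha ihb)
  have hobj : ∀ A, F.obj A = evalObj c A := by
    rintro (_ | t)
    · exact hF.obj_zero
    · exact htree t
  have hterm : ∀ {a b : FreeMagma X} (f : TreeTerm a b),
      HEq (F.map (X := tree a) (Y := tree b) (Hom.tree (TreeHom.mk f))) (evalFormal c f) := by
    intro a b f
    induction f with
    | id a =>
      refine (heq_of_eq (F.map_id (tree a))).trans ?_
      rw [htree]
      rfl
    | comp f g ih ih' =>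
      exact (heq_of_eq (F.map_comp (X := tree _) (Y := tree _) (Z := tree _)
        (Hom.tree (TreeHom.mk f)) (Hom.tree (TreeHom.mk g)))).trans
          (heq_comp (htree _) (htree _) (htree _) ih ih')
    | tensor f g ih ih' =>
      exact (hF.map_tensor (A := tree _) (A' := tree _) (B := tree _) (B' := tree _)
        (Hom.tree (TreeHom.mk f)) (Hom.tree (TreeHom.mk g))).trans
          (heq_tensor (htree _) (htree _) (htree _) (htree _) ih ih')
    | η a b d =>
      refine (hF.map_η (tree a) (tree b) (tree d)).trans ?_
      rw [htree, htree, htree]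
      rfl
  refine Functor.hext hobj ?_
  rintro _ _ (_ | ⟨⟨f⟩⟩)
  · refine (heq_of_eq (F.map_id FreeDirected.zero)).trans ?_
    rw [hobj]
    rfl
  · exact hterm f

/-! #### Substitution -/

section Substitution

variable {X Y : Type w} {C : Type u} [Category.{v} C] [DirectedMonoidal C]

theorem evalObj_evalTree (c : Y → C) (V : X → FreeDirected Y) (t : FreeMagma X) :
    evalObj c (evalTree V t) = evalTree (fun x => evalObj c (V x)) t := by
  induction t with
  | ih1 x => rfl
  | ih2 a b iha ihb => exact (evalObj_tensor c _ _).trans (congrArg₂ tensorObj iha ihb)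

theorem evalObj_evalObj (c : Y → C) (V : X → FreeDirected Y) (A : FreeDirected X) :
    evalObj c (evalObj V A) = evalObj (fun x => evalObj c (V x)) A := by
  cases A
  · rfl
  · exact evalObj_evalTree c V _

theorem evalMap_evalFormal (c : Y → C) (V : X → FreeDirected Y) {a b : FreeMagma X}
    (f : TreeTerm a b) :
    HEq (evalMap c (evalFormal V f)) (evalFormal (fun x => evalObj c (V x)) f) := by
  induction f with
  | id a =>
    refine (heq_of_eq (evalMap_id c _)).trans ?_
    rw [evalObj_evalTree]
    rfl
  | comp f g ih ih' =>
    exact (heq_of_eq (evalMap_comp c _ _)).trans (heq_comp (evalObj_evalTree c V _)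
      (evalObj_evalTree c V _) (evalObj_evalTree c V _) ih ih')
  | tensor f g ih ih' =>
    exact (evalMap_tensor c _ _).trans (heq_tensor (evalObj_evalTree c V _)
      (evalObj_evalTree c V _) (evalObj_evalTree c V _) (evalObj_evalTree c V _) ih ih')
  | η a b d =>
    refine (evalMap_η c _ _ _).trans ?_
    rw [evalObj_evalTree, evalObj_evalTree, evalObj_evalTree]
    rfl

theorem evalMap_evalMap (c : Y → C) (V : X → FreeDirected Y) {A B : FreeDirected X}
    (f : A ⟶ B) :
    HEq (evalMap c (evalMap V f)) (evalMap (fun x => evalObj c (V x)) f) := by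
  rcases f with _ | ⟨⟨f⟩⟩
  · rfl
  · exact evalMap_evalFormal c V f

theorem evalMap_evalNat (c : Y → C) {V V' : X → FreeDirected Y} (g : ∀ x, V x ⟶ V' x)
    (A : FreeDirected X) :
    HEq (evalMap c (evalNat g A)) (evalNat (fun x => evalMap c (g x)) A) := by
  rcases A with _ | t
  · rfl
  · change HEq (evalMap c (evalTreeNat g t)) (evalTreeNat (fun x => evalMap c (g x)) t)
    induction t with
    | ih1 x => rfl
    | ih2 a b iha ihb =>
      exact (evalMap_tensor c _ _).trans (heq_tensor (evalObj_evalTree c _ _)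
        (evalObj_evalTree c _ _) (evalObj_evalTree c _ _) (evalObj_evalTree c _ _) iha ihb)

theorem evalNat_evalObj {c c' : Y → C} (e : ∀ y, c y ⟶ c' y) (V : X → FreeDirected Y)
    (A : FreeDirected X) :
    HEq (evalNat e (evalObj V A)) (evalNat (fun x => evalNat e (V x)) A) := by
  rcases A with _ | t
  · rfl
  · change HEq (evalNat e (evalTree V t)) (evalTreeNat (fun x => evalNat e (V x)) t)
    induction t with
    | ih1 x => rfl
    | ih2 a b iha ihb =>
      exact (evalNat_tensor e _ _).trans (heq_tensor (evalObj_evalTree c _ _)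
        (evalObj_evalTree c' _ _) (evalObj_evalTree c _ _) (evalObj_evalTree c' _ _) iha ihb)

theorem act_act {A A' : FreeDirected X} {V V' : X → FreeDirected Y} {c c' : Y → C}
    (f : A ⟶ A') (g : ∀ x, V x ⟶ V' x) (e : ∀ y, c y ⟶ c' y) :
    HEq (act (act f g) e) (act f (fun x => act (g x) e)) := by
  simp only [act, evalMap_comp, evalNat_comp, Category.assoc]
  exact heq_comp (evalObj_evalObj c V A) (evalObj_evalObj c V A') (evalObj_evalObj c' V' A')
    (evalMap_evalMap c V f) (heq_comp (evalObj_evalObj c V A') (evalObj_evalObj c V' A')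
      (evalObj_evalObj c' V' A') (evalMap_evalNat c g A') (evalNat_evalObj e V' A'))

theorem act_heq {A A' : FreeDirected X} {c c' d d' : X → C} (f : A ⟶ A')
    {g : ∀ x, c x ⟶ c' x} {g' : ∀ x, d x ⟶ d' x} (h : ∀ x, c x = d x)
    (h' : ∀ x, c' x = d' x) (hg : ∀ x, HEq (g x) (g' x)) : HEq (act f g) (act f g') := by
  obtain rfl : c = d := funext h
  obtain rfl : c' = d' := funext h'
  obtain rfl : g = g' := funext fun x => eq_of_heq (hg x)
  rfl

theorem evalObj_of (A : FreeDirected X) : evalObj of A = A := by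
  rcases A with _ | t
  · rfl
  · change evalTree of t = tree t
    induction t with
    | ih1 x => rfl
    | ih2 a b iha ihb => exact congrArg₂ tensorObj iha ihb

theorem act_of {A A' : FreeDirected X} (f : A ⟶ A') :
    HEq (act f (fun x => 𝟙 (of x))) f := by
  have hterm : ∀ {a b : FreeMagma X} (f : TreeTerm a b),
      HEq (evalFormal of f) (show tree a ⟶ tree b from Hom.tree (TreeHom.mk f)) := by
    intro a b f
    have ho : ∀ t : FreeMagma X, evalTree of t = tree t := fun t => evalObj_of (tree t)
    induction f with
    | id a =>
      change HEq (𝟙 (evalTree of a)) (𝟙 (tree a))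
      rw [ho]
    | comp f g ih ih' => exact heq_comp (ho _) (ho _) (ho _) ih ih'
    | tensor f g ih ih' => exact heq_tensor (ho _) (ho _) (ho _) (ho _) ih ih'
    | η a b d =>
      change HEq (η (evalTree of a) (evalTree of b) (evalTree of d)) _
      rw [ho, ho, ho]
      rfl
  rw [act, evalNat_id, Category.comp_id]
  rcases f with _ | ⟨⟨f⟩⟩
  · rfl
  · exact hterm f

/-- The word of a tree. -/
def treeWord : FreeMagma X → List X
  | .of x => [x]
  | .mul a b => treeWord a ++ treeWord b

/-- The word in the generators that remains after removing all parentheses. -/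
def word : FreeDirected X → List X
  | zero => []
  | tree t => treeWord t

theorem word_tensor (A B : FreeDirected X) : word (tensorObj A B) = word A ++ word B := by
  rcases A with _ | a
  · rfl
  · rcases B with _ | b
    · exact (List.append_nil _).symm
    · rfl

theorem word_evalObj (V : X → FreeDirected Y) (A : FreeDirected X) :
    word (evalObj V A) = (word A).flatMap (fun x => word (V x)) := by
  rcases A with _ | t
  · rfl
  · change word (evalTree V t) = (treeWord t).flatMap (fun x => word (V x))
    induction t with
    | ih1 x => simp [evalTree, treeWord]
    | ih2 a b iha ihb =>
      exact (word_tensor _ _).trans (by rw [iha, ihb]; simp [treeWord])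

end Substitution

end FreeDirected

/-! ### The LaPlaza operad -/

open FreeDirected

/-- The category of `m`-ary operations of the LaPlaza operad: the full subcategory of the free
directed monoidal category on `x₁, …, x_m` on the objects that become `x₁ □ x₂ □ ⋯ □ x_m`
after removing all parentheses. -/
abbrev LaPlaza (m : ℕ) : Type :=
  ObjectProperty.FullSubcategory (fun A : FreeDirected (Fin m) => A.word = List.finRange m)

namespace LaPlaza

theorem flatMap_blockEquiv {m n : ℕ} (k : Fin m → ℕ) (h : ∑ i, k i = n) :
    ((List.finRange m).flatMap fun i => (List.finRange (k i)).map fun j =>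
      blockEquiv k h ⟨i, j⟩) = List.finRange n := by
  have hp : ((List.finRange m).flatMap fun i => (List.finRange (k i)).map fun j =>
      blockEquiv k h ⟨i, j⟩).Pairwise (· < ·) := by
    rw [List.pairwise_flatMap]
    refine ⟨fun i _ => ?_, ?_⟩
    · rw [List.pairwise_map]
      exact (List.sortedLT_finRange _).pairwise.imp fun hj => blockEquiv_lt_of_snd k h hj
    · refine (List.sortedLT_finRange m).pairwise.imp fun hi => ?_
      simp only [List.mem_map]
      rintro _ ⟨j, _, rfl⟩ _ ⟨j', _, rfl⟩
      exact blockEquiv_lt_of_fst k h hi j j'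
  refine List.Perm.eq_of_pairwise' (r := (· < ·)) hp (List.sortedLT_finRange n).pairwise ?_
  rw [List.perm_ext_iff_of_nodup (hp.imp fun hlt => ne_of_lt hlt) (List.nodup_finRange n)]
  intro y
  obtain ⟨⟨i, j⟩, rfl⟩ := (blockEquiv k h).surjective y
  simp only [List.mem_flatMap, List.mem_map, List.mem_finRange, true_and, iff_true]
  exact ⟨i, j, rfl⟩

/-- The operation in `LaPlaza (k i)` on the generators of the `i`-th block. -/
def blockGen {m n : ℕ} (k : Fin m → ℕ) (h : ∑ i, k i = n) (i : Fin m) (j : Fin (k i)) :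
    FreeDirected (Fin n) :=
  of (blockEquiv k h ⟨i, j⟩)

/-- Composition of operations on objects: substitute `U i`, with its generators renamed into
those of the `i`-th block, for the `i`-th generator of `T`. -/
def substObj {m n : ℕ} (k : Fin m → ℕ) (h : ∑ i, k i = n) (T : FreeDirected (Fin m))
    (U : ∀ i, FreeDirected (Fin (k i))) : FreeDirected (Fin n) :=
  evalObj (fun i => evalObj (blockGen k h i) (U i)) T

/-- Composition of operations on morphisms. -/
def substMap {m n : ℕ} (k : Fin m → ℕ) (h : ∑ i, k i = n) {T T' : FreeDirected (Fin m)}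
    {U U' : ∀ i, FreeDirected (Fin (k i))} (f : T ⟶ T') (g : ∀ i, U i ⟶ U' i) :
    substObj k h T U ⟶ substObj k h T' U' :=
  act f (fun i => act (g i) (fun j => 𝟙 (blockGen k h i j)))

theorem substMap_id {m n : ℕ} (k : Fin m → ℕ) (h : ∑ i, k i = n) (T : FreeDirected (Fin m))
    (U : ∀ i, FreeDirected (Fin (k i))) :
    substMap k h (𝟙 T) (fun i => 𝟙 (U i)) = 𝟙 (substObj k h T U) := by
  simp only [substMap, act_id]
  rfl

theorem substMap_comp {m n : ℕ} (k : Fin m → ℕ) (h : ∑ i, k i = n)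
    {T T' T'' : FreeDirected (Fin m)} {U U' U'' : ∀ i, FreeDirected (Fin (k i))}
    (f : T ⟶ T') (f' : T' ⟶ T'') (g : ∀ i, U i ⟶ U' i) (g' : ∀ i, U' i ⟶ U'' i) :
    substMap k h (f ≫ f') (fun i => g i ≫ g' i) = substMap k h f g ≫ substMap k h f' g' := by
  refine Eq.trans ?_ (act_comp _ _ _ _)
  rw [substMap]
  congr 1
  funext i
  rw [← act_comp]
  simp only [Category.comp_id]

theorem word_substObj {m n : ℕ} (k : Fin m → ℕ) (h : ∑ i, k i = n)
    {T : FreeDirected (Fin m)} {U : ∀ i, FreeDirected (Fin (k i))}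
    (hT : T.word = List.finRange m) (hU : ∀ i, (U i).word = List.finRange (k i)) :
    (substObj k h T U).word = List.finRange n := by
  rw [substObj, word_evalObj, hT, ← flatMap_blockEquiv k h]
  congr 1
  funext i
  rw [word_evalObj, hU, List.map_eq_flatMap]
  rfl

theorem heq_homMk {m : ℕ} {A A' B B' : LaPlaza m} (hA : A.obj = A'.obj) (hB : B.obj = B'.obj)
    {f : A ⟶ B} {g : A' ⟶ B'} (h : HEq f.hom g.hom) : HEq f g := by
  obtain ⟨A, _⟩ := A
  obtain ⟨A', _⟩ := A'
  obtain ⟨B, _⟩ := B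
  obtain ⟨B', _⟩ := B'
  obtain ⟨f⟩ := f
  obtain ⟨g⟩ := g
  dsimp only at hA hB h
  subst hA hB
  obtain rfl := eq_of_heq h
  rfl

theorem one_substObj {n : ℕ} (h : ∑ _ : Fin 1, n = n) (U : FreeDirected (Fin n)) :
    substObj (fun _ : Fin 1 => n) h (of 0) (fun _ => U) = U := by
  have : blockGen (fun _ : Fin 1 => n) h 0 = of := by
    funext j
    rw [blockGen, blockEquiv_one]
  change evalObj (blockGen (fun _ : Fin 1 => n) h 0) U = U
  rw [this, evalObj_of]

theorem one_substMap {n : ℕ} (h : ∑ _ : Fin 1, n = n) {U U' : FreeDirected (Fin n)}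
    (f : U ⟶ U') :
    HEq (substMap (fun _ : Fin 1 => n) h (𝟙 (of 0)) (fun _ => f)) f := by
  have : blockGen (fun _ : Fin 1 => n) h 0 = of := by
    funext j
    rw [blockGen, blockEquiv_one]
  have h1 : substMap (fun _ : Fin 1 => n) h (𝟙 (of 0)) (fun _ => f) =
      act f (fun j => 𝟙 (blockGen (fun _ : Fin 1 => n) h 0 j)) := by
    rw [substMap, act, evalMap_id]
    exact Category.id_comp _
  refine (heq_of_eq h1).trans ((act_heq f (congrFun this) (congrFun this) fun j => ?_).trans
    (act_of f))
  rw [this]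

theorem substObj_one {n : ℕ} (h : ∑ _ : Fin n, 1 = n) (T : FreeDirected (Fin n)) :
    substObj (fun _ : Fin n => 1) h T (fun _ => of 0) = T := by
  have : (fun i => evalObj (blockGen (fun _ : Fin n => 1) h i) (of 0)) = of := by
    funext i
    change blockGen (fun _ : Fin n => 1) h i 0 = of i
    rw [blockGen, blockEquiv_ones]
  rw [substObj, this, evalObj_of]

theorem substMap_one {n : ℕ} (h : ∑ _ : Fin n, 1 = n) {T T' : FreeDirected (Fin n)}
    (f : T ⟶ T') :
    HEq (substMap (fun _ : Fin n => 1) h f (fun _ => 𝟙 (of 0))) f := by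
  have h1 : ∀ i, evalObj (blockGen (fun _ : Fin n => 1) h i) (of 0) = of i := by
    intro i
    change blockGen (fun _ : Fin n => 1) h i 0 = of i
    rw [blockGen, blockEquiv_ones]
  refine (act_heq f h1 h1 fun i => ?_).trans (act_of f)
  rw [act_id, h1]

theorem substObj_assoc {m n p : ℕ} (k : Fin m → ℕ) (h : ∑ i, k i = n) (l : Fin n → ℕ)
    (h' : ∑ j, l j = p) (S : FreeDirected (Fin m)) (T : ∀ i, FreeDirected (Fin (k i)))
    (U : ∀ j, FreeDirected (Fin (l j))) :
    substObj l h' (substObj k h S T) U =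
      substObj (fun i => ∑ j, l (blockEquiv k h ⟨i, j⟩)) (sum_blockEquiv k h l h') S
        (fun i => substObj (fun j => l (blockEquiv k h ⟨i, j⟩)) rfl (T i)
          (fun j => U (blockEquiv k h ⟨i, j⟩))) := by
  simp only [substObj, evalObj_evalObj]
  exact congrArg (fun c => evalObj c S) (funext fun i => congrArg (fun c => evalObj c (T i))
    (funext fun j => congrArg (fun c => evalObj c (U (blockEquiv k h ⟨i, j⟩)))
      (funext fun x => congrArg of (blockEquiv_assoc k h l h' i j x).symm)))

theorem substMap_assoc {m n p : ℕ} (k : Fin m → ℕ) (h : ∑ i, k i = n) (l : Fin n → ℕ)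
    (h' : ∑ j, l j = p) {S S' : FreeDirected (Fin m)} {T T' : ∀ i, FreeDirected (Fin (k i))}
    {U U' : ∀ j, FreeDirected (Fin (l j))} (f : S ⟶ S') (g : ∀ i, T i ⟶ T' i)
    (e : ∀ j, U j ⟶ U' j) :
    HEq (substMap l h' (substMap k h f g) e)
      (substMap (fun i => ∑ j, l (blockEquiv k h ⟨i, j⟩)) (sum_blockEquiv k h l h') f
        (fun i => substMap (fun j => l (blockEquiv k h ⟨i, j⟩)) rfl (g i)
          (fun j => e (blockEquiv k h ⟨i, j⟩)))) := by
  have hE : ∀ y, act (𝟙 (of y)) (fun y => act (e y) (fun x => 𝟙 (blockGen l h' y x))) =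
      act (e y) (fun x => 𝟙 (blockGen l h' y x)) := by
    intro y
    rw [act, evalMap_id]
    exact Category.id_comp _
  have hx : ∀ (i : Fin m) (j : Fin (k i)) (x : Fin (l (blockEquiv k h ⟨i, j⟩))),
      blockGen l h' (blockEquiv k h ⟨i, j⟩) x =
        evalObj (blockGen (fun i => ∑ j, l (blockEquiv k h ⟨i, j⟩)) (sum_blockEquiv k h l h') i)
          (blockGen (fun j => l (blockEquiv k h ⟨i, j⟩)) rfl j x) :=
    fun i j x => congrArg of (blockEquiv_assoc k h l h' i j x).symm
  have hj : ∀ (U : ∀ j, FreeDirected (Fin (l j))) (i : Fin m) (j : Fin (k i)),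
      evalObj (fun y => evalObj (blockGen l h' y) (U y)) (blockGen k h i j) =
        evalObj (blockGen (fun i => ∑ j, l (blockEquiv k h ⟨i, j⟩)) (sum_blockEquiv k h l h') i)
          (evalObj (blockGen (fun j => l (blockEquiv k h ⟨i, j⟩)) rfl j)
            (U (blockEquiv k h ⟨i, j⟩))) := by
    intro U i j
    rw [evalObj_evalObj]
    exact congrArg (fun c => evalObj c (U (blockEquiv k h ⟨i, j⟩))) (funext (hx i j))
  have hi : ∀ (T : ∀ i, FreeDirected (Fin (k i))) (U : ∀ j, FreeDirected (Fin (l j)))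
      (i : Fin m),
      evalObj (fun y => evalObj (blockGen l h' y) (U y)) (evalObj (blockGen k h i) (T i)) =
        evalObj (blockGen (fun i => ∑ j, l (blockEquiv k h ⟨i, j⟩)) (sum_blockEquiv k h l h') i)
          (substObj (fun j => l (blockEquiv k h ⟨i, j⟩)) rfl (T i)
            (fun j => U (blockEquiv k h ⟨i, j⟩))) := by
    intro T U i
    rw [substObj, evalObj_evalObj, evalObj_evalObj]
    exact congrArg (fun c => evalObj c (T i)) (funext (hj U i))
  refine (act_act _ _ _).trans (act_heq f (hi T U) (hi T' U') fun i => ?_)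
  refine (act_act _ _ _).trans (HEq.trans ?_ (act_act _ _ _).symm)
  refine act_heq (g i) (hj U i) ?_ fun j => ?_
  · exact hj U' i
  refine (heq_of_eq (hE _)).trans (HEq.trans ?_ (act_act _ _ _).symm)
  refine act_heq _ (hx i j) (hx i j) fun x => ?_
  rw [act_id, ← hx i j x]

end LaPlaza

/-- The LaPlaza operad: the operad in `CAT` which acts on directed monoidal categories. -/
def laPlazaOperad : CatOperad where
  Op := LaPlaza
  one := ⟨of 0, rfl⟩
  γ k h :=
    { obj := fun A => ⟨LaPlaza.substObj k h A.1.obj (fun i => (A.2 i).obj),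
        LaPlaza.word_substObj k h A.1.property (fun i => (A.2 i).property)⟩
      map := fun f =>
        ObjectProperty.homMk (LaPlaza.substMap k h f.1.hom (fun i => (f.2 i).hom))
      map_id := fun A => by
        apply ObjectProperty.hom_ext
        exact LaPlaza.substMap_id k h _ _
      map_comp := fun f g => by
        apply ObjectProperty.hom_ext
        exact LaPlaza.substMap_comp k h _ _ _ _ }
  one_γ_obj h T := ObjectProperty.FullSubcategory.ext (LaPlaza.one_substObj h T.obj)
  one_γ_map h T T' f := LaPlaza.heq_homMk (LaPlaza.one_substObj h _)
    (LaPlaza.one_substObj h _) (LaPlaza.one_substMap h f.hom)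
  γ_one_obj h T := ObjectProperty.FullSubcategory.ext (LaPlaza.substObj_one h T.obj)
  γ_one_map h T T' f := LaPlaza.heq_homMk (LaPlaza.substObj_one h _)
    (LaPlaza.substObj_one h _) (LaPlaza.substMap_one h f.hom)
  γ_assoc_obj k h l h' S T U := ObjectProperty.FullSubcategory.ext
    (LaPlaza.substObj_assoc k h l h' S.obj (fun i => (T i).obj) (fun j => (U j).obj))
  γ_assoc_map k h l h' S S' T T' U U' f g e := LaPlaza.heq_homMk
    (LaPlaza.substObj_assoc k h l h' S.obj (fun i => (T i).obj) (fun j => (U j).obj))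
    (LaPlaza.substObj_assoc k h l h' S'.obj (fun i => (T' i).obj) (fun j => (U' j).obj))
    (LaPlaza.substMap_assoc k h l h' f.hom (fun i => (g i).hom) (fun j => (e j).hom))

/-! ### The generating associator -/

/-- The parenthesized word `(x₁x₂)x₃`. -/
def ParenWord.leftThree : ParenWord 3 where
  parens := {Set.Icc 0 1}
  isInterval := by
    rintro _ rfl
    exact ⟨0, 1, rfl⟩
  nontrivial := by
    rintro _ rfl
    exact ⟨0, by simp, 1, by simp, by simp⟩
  ne_univ := by
    rintro _ rfl h
    have : (2 : Fin 3) ∈ Set.Icc (0 : Fin 3) 1 := h ▸ Set.mem_univ _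
    exact absurd this.2 (by decide)
  nested := by
    rintro _ rfl _ rfl
    exact Or.inl subset_rfl

/-- The morphism `(x₁x₂)x₃ ⟶ x₁x₂x₃` of the associahedral operad. -/
def associahedralArrow : ParenWord.leftThree ⟶ ParenWord.bare 3 :=
  homOfLE (Set.empty_subset _)

/-- The morphism `η : (x₁ □ x₂) □ x₃ ⟶ x₁ □ (x₂ □ x₃)` of the LaPlaza operad. -/
def laPlazaArrow :
    (⟨tensorObj (tensorObj (of 0) (of 1)) (of 2), rfl⟩ : LaPlaza 3) ⟶
      ⟨tensorObj (of 0) (tensorObj (of 1) (of 2)), rfl⟩ :=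
  ObjectProperty.homMk (η (of 0) (of 1) (of 2))

end

/-! ### Coherence: the free directed monoidal category is thin -/

section

open FreeDirected

namespace FreeDirected

/-! The map sends a parenthesized word to the object obtained by bracketing to the right inside
every pair of parentheses. Two facts about the free directed monoidal category make this work.

Coherence: parallel morphisms are equal (`TreeHom.subsingleton`). A morphism into `t₁ □ t₂` factors
as a canonical iterated `η` that brings some subtree on the left spine of the source to the root,
followed by a product of two morphisms (`LeftCut.natural`). The number of leaves of `t₁` determines
that subtree, so induction on the target applies. After this, functoriality and every equation
between morphisms cost nothing; only equality of objects and existence of morphisms remain.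

Combinatorics of supports: a tree with increasing labels is encoded by the label sets of its
subtrees. For a word `S`, `rightClosure` collects the final segments of nodes of `S` that are
compatible with all nodes. Its members are pairwise nested or disjoint, so at most one tree has all
its supports there (`eq_of_compatible`), and `exists_tree` builds one. Being characterized in this
way, the right bracketing commutes with substitution, because right closures are carried into right
closures. Dropping parentheses yields a morphism by the criterion `nonempty_treeHom`.

Surjectivity: an object is the right bracketing of the word formed by all of its own parentheses.
Every morphism is a composite of rotations, that is, single uses of `η` inside a tree. For a
rotation `s → t`, dropping from the parentheses of `s` those that `t` lacks gives a word whose right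
bracketing is `t` (`rightBracketing_common`), so the rotation is the image of one morphism of words.
-/

theorem treeWord_ne_nil {X : Type u} (t : FreeMagma X) : treeWord t ≠ [] := by
  induction t using FreeMagma.rec with
  | of x => exact List.cons_ne_nil _ _
  | mul a b iha _ => exact List.append_ne_nil_of_left_ne_nil iha _

end FreeDirected

namespace TreeHom

variable {X : Type u}

theorem comp_assoc {a b c d : FreeMagma X} (f : TreeHom a b) (g : TreeHom b c)
    (h : TreeHom c d) : (f.comp g).comp h = f.comp (g.comp h) := by
  induction f using TreeHom.ind with | _ f
  induction g using TreeHom.ind with | _ g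
  induction h using TreeHom.ind with | _ h
  exact sound (.assoc f g h)

theorem tensor_comp {a a' a'' b b' b'' : FreeMagma X} (f : TreeHom a a') (f' : TreeHom a' a'')
    (g : TreeHom b b') (g' : TreeHom b' b'') :
    (f.comp f').tensor (g.comp g') = (f.tensor g).comp (f'.tensor g') := by
  induction f using TreeHom.ind with | _ f
  induction f' using TreeHom.ind with | _ f'
  induction g using TreeHom.ind with | _ g
  induction g' using TreeHom.ind with | _ g'
  exact sound (.tensor_comp f f' g g')

theorem η_naturality {a a' b b' c c' : FreeMagma X} (f : TreeHom a a') (g : TreeHom b b')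
    (h : TreeHom c c') :
    ((f.tensor g).tensor h).comp (mk (.η a' b' c')) =
      (mk (.η a b c)).comp (f.tensor (g.tensor h)) := by
  induction f using TreeHom.ind with | _ f
  induction g using TreeHom.ind with | _ g
  induction h using TreeHom.ind with | _ h
  exact sound (.η_naturality f g h)

theorem pentagon (a b c d : FreeMagma X) :
    (mk (.η (.mul a b) c d)).comp (mk (.η a b (.mul c d))) =
      ((mk (.η a b c)).tensor (mk (.id d))).comp
        ((mk (.η a (.mul b c) d)).comp ((mk (.id a)).tensor (mk (.η b c d)))) :=
  sound (.pentagon a b c d)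

end TreeHom

/-- `LeftCut s l r` says that `l` is a proper subtree of `s` containing the first leaf of `s`,
and that `r` is what remains of `s` when `l` is removed. -/
inductive LeftCut {X : Type u} : FreeMagma X → FreeMagma X → FreeMagma X → Type u
  | root (a b) : LeftCut (.mul a b) a b
  | left {a l r} (c : LeftCut a l r) (b) : LeftCut (.mul a b) l (.mul r b)

/-! ### Left cuts: their morphisms, naturality and uniqueness -/

namespace LeftCut

variable {X : Type u}

/-- The canonical morphism that brings a left cut to the root. -/
def hom : ∀ {s l r : FreeMagma X}, LeftCut s l r → TreeHom s (.mul l r)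
  | _, _, _, root a b => .mk (.id (.mul a b))
  | _, _, _, @left _ _ l r c b => ((hom c).tensor (.mk (.id b))).comp (.mk (.η l r b))

theorem treeWord_eq {s l r : FreeMagma X} (c : LeftCut s l r) :
    treeWord s = treeWord l ++ treeWord r := by
  induction c with
  | root a b => rfl
  | left c b ih => simp [treeWord, ih, List.append_assoc]

/-- Cuts pull back along morphisms. By induction on the formal morphism, a product moves past the
cut by naturality of `η`, and `η` itself moves past it by the pentagon. Applied to the root cut of
the target, this is the normal form behind coherence. -/
theorem natural {s t : FreeMagma X} (f : TreeTerm s t) {l r : FreeMagma X}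
    (c : LeftCut t l r) : ∃ (l' r' : FreeMagma X) (c' : LeftCut s l' r')
      (f₁ : TreeHom l' l) (f₂ : TreeHom r' r),
      (TreeHom.mk f).comp c.hom = c'.hom.comp (f₁.tensor f₂) := by
  induction f generalizing l r with
  | id a =>
    exact ⟨l, r, c, .mk (.id l), .mk (.id r), by
      rw [TreeHom.id_comp, TreeHom.tensor_id, TreeHom.comp_id]⟩
  | comp f g ih ih' =>
    obtain ⟨l', r', c', g₁, g₂, hg⟩ := ih' c
    obtain ⟨l'', r'', c'', f₁, f₂, hf⟩ := ih c'
    refine ⟨l'', r'', c'', f₁.comp g₁, f₂.comp g₂, ?_⟩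
    rw [TreeHom.mk_comp, TreeHom.comp_assoc, hg, ← TreeHom.comp_assoc, hf, TreeHom.comp_assoc,
      TreeHom.tensor_comp]
  | tensor f g ih ih' =>
    rename_i a a' b b'
    cases c with
    | root =>
      exact ⟨_, _, .root _ _, .mk f, .mk g, by
        rw [hom, hom, TreeHom.comp_id, TreeHom.id_comp, TreeHom.mk_tensor]⟩
    | left c =>
      obtain ⟨l', r', c', f₁, f₂, hf⟩ := ih c
      refine ⟨l', _, .left c' _, f₁, f₂.tensor (.mk g), ?_⟩
      rw [hom, hom, TreeHom.mk_tensor, ← TreeHom.comp_assoc, ← TreeHom.tensor_comp, hf,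
        TreeHom.comp_assoc, ← TreeHom.η_naturality, ← TreeHom.comp_assoc, ← TreeHom.tensor_comp,
        TreeHom.id_comp, TreeHom.comp_id]
  | η x y z =>
    cases c with
    | root =>
      -- The morphism of the cut of `(x □ y) □ z` at `x` is `η` itself, so identities remain.
      refine ⟨_, _, .left (.root x y) z, .mk (.id x), .mk (.id _), ?_⟩
      rw [hom, hom, hom, TreeHom.tensor_id, TreeHom.tensor_id, TreeHom.id_comp]
    | left c =>
      rename_i r
      -- The cut lies inside `x`. The pentagon splits the two successive `η` so that the last one
      -- acts on the right part only.
      refine ⟨_, _, .left (.left c y) z, .mk (.id _), .mk (.η r y z), ?_⟩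
      rw [hom, hom, hom, ← TreeHom.tensor_id y z, ← TreeHom.comp_assoc, ← TreeHom.η_naturality,
        TreeHom.comp_assoc, TreeHom.pentagon, TreeHom.comp_assoc, ← TreeHom.comp_assoc,
        ← TreeHom.tensor_comp, TreeHom.comp_id]

/-- The left parts of cuts form the left spine of `s`, along which the number of leaves strictly
decreases. -/
theorem unique {s l r l' r' : FreeMagma X} (c : LeftCut s l r) (c' : LeftCut s l' r')
    (h : (treeWord l).length = (treeWord l').length) :
    (⟨l, r, c⟩ : Σ l r, LeftCut s l r) = ⟨l', r', c'⟩ := by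
  have pos : ∀ t : FreeMagma X, 0 < (treeWord t).length := fun t =>
    List.length_pos_of_ne_nil (treeWord_ne_nil t)
  induction c generalizing l' r' with
  | root a b =>
    cases c' with
    | root => rfl
    | left c' =>
      rename_i r'
      have := c'.treeWord_eq
      have := congrArg List.length this
      have := pos r'
      simp only [List.length_append] at *
      omega
  | left c b ih =>
    rename_i a l r
    cases c' with
    | root =>
      have := c.treeWord_eq
      have := congrArg List.length this
      have := pos r
      simp only [List.length_append] at *
      omega
    | left c' =>
      have := ih c' h
      cases this
      rfl

end LeftCut

namespace TreeHom

variable {X : Type u}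

theorem treeWord_eq {s t : FreeMagma X} (f : TreeTerm s t) : treeWord s = treeWord t := by
  induction f with
  | id a => rfl
  | comp f g ih ih' => exact ih.trans ih'
  | tensor f g ih ih' => exact congrArg₂ (· ++ ·) ih ih'
  | η a b c => exact List.append_assoc _ _ _

/-- Neither a product nor `η` has a leaf as its source, so only composites of identities occur. The
source is kept variable, with an equation, so that induction on `f` is possible. -/
theorem heq_id_of_leaf {s t : FreeMagma X} (f : TreeTerm s t) (x : X) (h : s = .of x) :
    t = .of x ∧ HEq (mk f) (mk (.id (.of x))) := by
  induction f with
  | id a => subst h; exact ⟨rfl, HEq.rfl⟩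
  | comp f g ih ih' =>
    obtain ⟨rfl, hf⟩ := ih h
    obtain ⟨rfl, hg⟩ := ih' rfl
    subst h
    refine ⟨rfl, ?_⟩
    rw [mk_comp, eq_of_heq hf, eq_of_heq hg, id_comp]
  | tensor => cases h
  | η => cases h

/-- Coherence: parallel morphisms between trees are equal. -/
instance subsingleton (s t : FreeMagma X) : Subsingleton (TreeHom s t) := by
  refine ⟨fun f g => ?_⟩
  induction t using FreeMagma.rec generalizing s with
  | of x =>
    induction f using TreeHom.ind with | _ f
    induction g using TreeHom.ind with | _ g
    have hs : s = .of x := by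
      have h := treeWord_eq f
      cases s with
      | of y => exact congrArg FreeMagma.of (by simpa [treeWord] using h)
      | mul a b =>
        simp [treeWord, List.append_eq_singleton_iff, treeWord_ne_nil] at h
    subst hs
    exact eq_of_heq ((heq_id_of_leaf f x rfl).2.trans (heq_id_of_leaf g x rfl).2.symm)
  | mul t₁ t₂ ih₁ ih₂ =>
    induction f using TreeHom.ind with | _ f
    induction g using TreeHom.ind with | _ g
    -- The morphism of the root cut is an identity, so each of `f`, `g` becomes a cut of the source
    -- followed by a product of morphisms into `t₁` and `t₂`.
    obtain ⟨l, r, c, f₁, f₂, hf⟩ := LeftCut.natural f (.root t₁ t₂)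
    obtain ⟨l', r', c', g₁, g₂, hg⟩ := LeftCut.natural g (.root t₁ t₂)
    rw [LeftCut.hom, comp_id] at hf hg
    -- Morphisms preserve words, so both left parts spell the word of `t₁` and the two cuts
    -- coincide.
    have hl : (treeWord l).length = (treeWord l').length := by
      have h₁ : treeWord l = treeWord t₁ := by
        induction f₁ using TreeHom.ind with | _ f₁
        exact treeWord_eq f₁
      have h₂ : treeWord l' = treeWord t₁ := by
        induction g₁ using TreeHom.ind with | _ g₁
        exact treeWord_eq g₁
      rw [h₁, h₂]
    cases LeftCut.unique c c' hl
    rw [hf, hg, ih₁ _ f₁ g₁, ih₂ _ f₂ g₂]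

end TreeHom

namespace FreeDirected

variable {X : Type u}

instance (A B : FreeDirected X) : Subsingleton (A ⟶ B) := by
  refine ⟨fun f g => ?_⟩
  rcases f with _ | f <;> rcases g with _ | g
  · rfl
  · rw [Subsingleton.elim f g]

end FreeDirected

/-- This reduces the construction of a map of operads to objects and to the existence of morphisms.
-/
instance LaPlaza.subsingleton_hom {m : ℕ} (A B : LaPlaza m) : Subsingleton (A ⟶ B) :=
  ⟨fun _ _ => ObjectProperty.hom_ext _ (Subsingleton.elim _ _)⟩

end

/-! ### Supports of subtrees -/

/-- Two sets are compatible if they are nested or disjoint. -/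
def Compatible {X : Type u} (I J : Set X) : Prop := I ⊆ J ∨ J ⊆ I ∨ Disjoint I J

namespace Compatible

variable {X : Type u} {I J : Set X}

theorem symm (h : Compatible I J) : Compatible J I := by
  rcases h with h | h | h
  · exact Or.inr (Or.inl h)
  · exact Or.inl h
  · exact Or.inr (Or.inr h.symm)

theorem of_subsingleton (hJ : J.Subsingleton) (I : Set X) : Compatible I J := by
  rcases hJ.eq_empty_or_singleton with rfl | ⟨x, rfl⟩
  · exact Or.inr (Or.inl (Set.empty_subset _))
  · by_cases hx : x ∈ I
    · exact Or.inr (Or.inl (Set.singleton_subset_iff.mpr hx))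
    · exact Or.inr (Or.inr (Set.disjoint_singleton_right.mpr hx))

/-- A set compatible with `I` that meets both `I` and its complement contains `I`. -/
theorem subset_of_mem (h : Compatible I J) {x y : X} (hx : x ∈ I) (hx' : x ∈ J) (hy : y ∈ J)
    (hy' : y ∉ I) : I ⊆ J := by
  rcases h with h | h | h
  · exact h
  · exact absurd (h hy) hy'
  · exact absurd hx' (Set.disjoint_left.mp h hx)

end Compatible

section

open FreeDirected

namespace FreeDirected

variable {X : Type u}

/-- The set of labels of the leaves of a tree. -/
def treeSupport (t : FreeMagma X) : Set X := {x | x ∈ treeWord t}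

/-- The subtrees of a tree. -/
def subtrees : FreeMagma X → Set (FreeMagma X)
  | .of x => {.of x}
  | .mul a b => insert (.mul a b) (subtrees a ∪ subtrees b)

theorem treeSupport_of (x : X) : treeSupport (.of x) = {x} := by
  ext y
  simp [treeSupport, treeWord]

theorem treeSupport_mul (a b : FreeMagma X) :
    treeSupport (.mul a b) = treeSupport a ∪ treeSupport b := by
  ext y
  simp only [treeSupport, treeWord, Set.mem_ofPred_eq, List.mem_append, Set.mem_union]

theorem treeSupport_nonempty (t : FreeMagma X) : (treeSupport t).Nonempty := by
  induction t using FreeMagma.rec with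
  | of x => exact ⟨x, by simp [treeSupport_of]⟩
  | mul a b iha ihb => rw [treeSupport_mul]; exact iha.inl

theorem mem_subtrees_self (t : FreeMagma X) : t ∈ subtrees t := by
  cases t with
  | of x => exact rfl
  | mul a b => exact Or.inl rfl

theorem subtrees_trans {s t u : FreeMagma X} (h : s ∈ subtrees t) (h' : u ∈ subtrees s) :
    u ∈ subtrees t := by
  induction t using FreeMagma.rec with
  | of x => obtain rfl : s = .of x := h; exact h'
  | mul a b iha ihb =>
    rcases h with rfl | h | h
    · exact h'
    · exact Or.inr (Or.inl (iha h))
    · exact Or.inr (Or.inr (ihb h))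

theorem treeSupport_subset {t u : FreeMagma X} (h : u ∈ subtrees t) :
    treeSupport u ⊆ treeSupport t := by
  induction t using FreeMagma.rec with
  | of x => obtain rfl : u = .of x := h; exact subset_rfl
  | mul a b iha ihb =>
    rcases h with rfl | h | h
    · exact subset_rfl
    · exact (iha h).trans (by rw [treeSupport_mul]; exact Set.subset_union_left)
    · exact (ihb h).trans (by rw [treeSupport_mul]; exact Set.subset_union_right)

theorem _root_.LeftCut.treeSupport_eq {s l r : FreeMagma X} (c : LeftCut s l r) :
    treeSupport s = treeSupport l ∪ treeSupport r := by
  rw [← treeSupport_mul, treeSupport, treeSupport, treeWord, c.treeWord_eq]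

theorem _root_.LeftCut.mem_subtrees {s l r : FreeMagma X} (c : LeftCut s l r) :
    l ∈ subtrees s := by
  induction c with
  | root a b => exact Or.inr (Or.inl (mem_subtrees_self a))
  | left c b ih => exact Or.inr (Or.inl ih)

/-- A single application of `η` inside a tree. -/
inductive Rotation : FreeMagma X → FreeMagma X → Prop
  | η (a b c) : Rotation (.mul (.mul a b) c) (.mul a (.mul b c))
  | left {a a'} (h : Rotation a a') (b) : Rotation (.mul a b) (.mul a' b)
  | right (a) {b b'} (h : Rotation b b') : Rotation (.mul a b) (.mul a b')

/-- A product of morphisms is carried out in one factor at a time, left factor first. -/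
theorem reflTransGen_rotation {s t : FreeMagma X} (f : TreeTerm s t) :
    Relation.ReflTransGen Rotation s t := by
  induction f with
  | id a => exact .refl
  | comp f g ih ih' => exact ih.trans ih'
  | tensor f g ih ih' =>
    exact (ih.lift (fun a => FreeMagma.mul a _) fun _ _ h => Rotation.left h _).trans
      (ih'.lift (fun b => FreeMagma.mul _ b) fun _ _ h => Rotation.right _ h)
  | η a b c => exact .single (.η a b c)

theorem Rotation.nonempty_treeTerm {s t : FreeMagma X} (h : Rotation s t) :
    Nonempty (TreeTerm s t) := by
  induction h with
  | η a b c => exact ⟨.η a b c⟩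
  | left h b ih => exact ih.map fun f => .tensor f (.id b)
  | right a h ih => exact ih.map fun f => .tensor (.id a) f

theorem Rotation.treeWord_eq {s t : FreeMagma X} (h : Rotation s t) :
    treeWord s = treeWord t := by
  obtain ⟨f⟩ := h.nonempty_treeTerm
  exact TreeHom.treeWord_eq f

/-! ### Trees with increasing labels -/

variable [LinearOrder X]

/-- The labels of the leaves are strictly increasing. -/
def TreeSorted (t : FreeMagma X) : Prop := (treeWord t).Pairwise (· < ·)

theorem treeSorted_mul {a b : FreeMagma X} : TreeSorted (.mul a b) ↔
    TreeSorted a ∧ TreeSorted b ∧ ∀ x ∈ treeSupport a, ∀ y ∈ treeSupport b, x < y :=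
  List.pairwise_append

theorem TreeSorted.disjoint {a b : FreeMagma X} (h : TreeSorted (.mul a b)) {x : X}
    (hx : x ∈ treeSupport a) : x ∉ treeSupport b :=
  fun hx' => lt_irrefl x ((treeSorted_mul.mp h).2.2 x hx x hx')

theorem TreeSorted.subtree {t u : FreeMagma X} (h : TreeSorted t) (hu : u ∈ subtrees t) :
    TreeSorted u := by
  induction t using FreeMagma.rec with
  | of x => obtain rfl : u = .of x := hu; exact h
  | mul a b iha ihb =>
    have h' := treeSorted_mul.mp h
    rcases hu with rfl | hu | hu
    · exact h
    · exact iha h'.1 hu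
    · exact ihb h'.2.1 hu

theorem TreeSorted.eq_of_support_subsingleton {t : FreeMagma X} (h : TreeSorted t) {x : X}
    (hx : treeSupport t = {x}) : t = .of x := by
  cases t with
  | of y =>
    rw [treeSupport_of, Set.singleton_eq_singleton_iff] at hx
    rw [hx]
  | mul a b =>
    obtain ⟨y, hy⟩ := treeSupport_nonempty a
    obtain ⟨z, hz⟩ := treeSupport_nonempty b
    have := (treeSorted_mul.mp h).2.2 y hy z hz
    rw [treeSupport_mul] at hx
    have h₁ : y = x := hx.subset (Or.inl hy)
    have h₂ : z = x := hx.subset (Or.inr hz)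
    rw [h₁, h₂] at this
    exact absurd this (lt_irrefl _)

theorem TreeSorted.compatible {t u v : FreeMagma X} (h : TreeSorted t) (hu : u ∈ subtrees t)
    (hv : v ∈ subtrees t) : Compatible (treeSupport u) (treeSupport v) := by
  induction t using FreeMagma.rec with
  | of x =>
    obtain rfl : u = .of x := hu
    obtain rfl : v = .of x := hv
    exact Or.inl subset_rfl
  | mul a b iha ihb =>
    have h' := treeSorted_mul.mp h
    rcases hu with rfl | hu' | hu'
    · exact Or.inr (Or.inl (treeSupport_subset hv))
    · rcases hv with rfl | hv' | hv'
      · exact Or.inl (treeSupport_subset (Or.inr (Or.inl hu')))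
      · exact iha h'.1 hu' hv'
      · exact Or.inr (Or.inr (Set.disjoint_left.mpr fun x hx hx' =>
          h.disjoint (treeSupport_subset hu' hx) (treeSupport_subset hv' hx')))
    · rcases hv with rfl | hv' | hv'
      · exact Or.inl (treeSupport_subset (Or.inr (Or.inr hu')))
      · exact Or.inr (Or.inr (Set.disjoint_left.mpr fun x hx hx' =>
          h.disjoint (treeSupport_subset hv' hx') (treeSupport_subset hu' hx)))
      · exact ihb h'.2.1 hu' hv'

/-- Convexity of supports: a label outside the half that contains `u` lies entirely on one side of
`u`. -/
theorem TreeSorted.mem_of_le_of_le {t u : FreeMagma X} (h : TreeSorted t)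
    (hu : u ∈ subtrees t) {x y z : X} (hx : x ∈ treeSupport u) (hy : y ∈ treeSupport u)
    (hz : z ∈ treeSupport t) (hxz : x ≤ z) (hzy : z ≤ y) : z ∈ treeSupport u := by
  induction t using FreeMagma.rec with
  | of x => obtain rfl : u = .of x := hu; exact hz
  | mul a b iha ihb =>
    have h' := treeSorted_mul.mp h
    rcases hu with rfl | hu' | hu'
    · exact hz
    · rw [treeSupport_mul] at hz
      rcases hz with hz | hz
      · exact iha h'.1 hu' hz
      · exact absurd hzy (h'.2.2 y (treeSupport_subset hu' hy) z hz).not_ge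
    · rw [treeSupport_mul] at hz
      rcases hz with hz | hz
      · exact absurd hxz (h'.2.2 z hz x (treeSupport_subset hu' hx)).not_ge
      · exact ihb h'.2.1 hu' hz

/-- A tree with increasing labels is determined by the supports of its subtrees. -/
theorem eq_of_compatible {s t : FreeMagma X} (hs : TreeSorted s) (ht : TreeSorted t)
    (hst : treeSupport s = treeSupport t)
    (h : ∀ u ∈ subtrees s, ∀ v ∈ subtrees t, Compatible (treeSupport u) (treeSupport v)) :
    s = t := by
  -- If `c` were not inside `a`, it would meet `b`, and the ordering would put `a` inside `c`.
  -- Compatibility then forces `b` into `c` as well, which leaves no label for `d`.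
  have aux : ∀ {a b c d : FreeMagma X}, TreeSorted (.mul a b) → TreeSorted (.mul c d) →
      treeSupport a ∪ treeSupport b = treeSupport c ∪ treeSupport d →
      Compatible (treeSupport b) (treeSupport c) → treeSupport c ⊆ treeSupport a := by
    intro a b c d hab hcd he hbc x hx
    by_contra hxa
    have hxb : x ∈ treeSupport b := (he.superset (Or.inl hx)).resolve_left hxa
    have hac : treeSupport a ⊆ treeSupport c := by
      intro y hy
      refine (he.subset (Or.inl hy)).resolve_right fun hyd => ?_
      exact lt_asymm ((treeSorted_mul.mp hab).2.2 y hy x hxb)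
        ((treeSorted_mul.mp hcd).2.2 x hx y hyd)
    obtain ⟨y, hy⟩ := treeSupport_nonempty a
    have hbc' := hbc.subset_of_mem hxb hx (hac hy) (hab.disjoint hy)
    obtain ⟨z, hz⟩ := treeSupport_nonempty d
    rcases he.superset (Or.inr hz) with hz' | hz'
    · exact hcd.disjoint (hac hz') hz
    · exact hcd.disjoint (hbc' hz') hz
  induction s using FreeMagma.rec generalizing t with
  | of x => exact (ht.eq_of_support_subsingleton (hst.symm.trans (treeSupport_of x))).symm
  | mul a b iha ihb =>
    cases t with
    | of x => exact hs.eq_of_support_subsingleton (hst.trans (treeSupport_of x))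
    | mul c d =>
      have hs' := treeSorted_mul.mp hs
      have ht' := treeSorted_mul.mp ht
      rw [treeSupport_mul, treeSupport_mul] at hst
      have hac : treeSupport a = treeSupport c :=
        Set.Subset.antisymm
          (aux ht hs hst.symm (h a (Or.inr (Or.inl (mem_subtrees_self a))) d
            (Or.inr (Or.inr (mem_subtrees_self d)))).symm)
          (aux hs ht hst (h b (Or.inr (Or.inr (mem_subtrees_self b))) c
            (Or.inr (Or.inl (mem_subtrees_self c)))))
      have hbd : treeSupport b = treeSupport d := by
        ext x
        constructor
        · intro hx
          exact (hst.subset (Or.inr hx)).resolve_left fun hc => hs.disjoint (hac.superset hc) hx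
        · intro hx
          exact (hst.superset (Or.inr hx)).resolve_left fun ha =>
            ht.disjoint (hac.subset ha) hx
      rw [iha hs'.1 ht'.1 hac fun u hu v hv => h u (Or.inr (Or.inl hu)) v (Or.inr (Or.inl hv)),
        ihb hs'.2.1 ht'.2.1 hbd fun u hu v hv => h u (Or.inr (Or.inr hu)) v (Or.inr (Or.inr hv))]

/-! ### Existence of morphisms -/

theorem _root_.LeftCut.treeSorted {s l r : FreeMagma X} (c : LeftCut s l r)
    (hs : TreeSorted s) : TreeSorted (.mul l r) := by
  rw [TreeSorted, treeWord, ← c.treeWord_eq]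
  exact hs

/-- The right part of a cut need not be a subtree of `s`, but the support of each of its subtrees is
the trace of a support in `s`. This lets hypotheses on the subtrees of `s` pass to `r`. -/
theorem _root_.LeftCut.exists_subtree {s l r : FreeMagma X} (c : LeftCut s l r)
    (hs : TreeSorted s) {u : FreeMagma X} (hu : u ∈ subtrees r) :
    ∃ v ∈ subtrees s, treeSupport u = treeSupport v ∩ treeSupport r := by
  induction c with
  | root a b =>
    exact ⟨u, Or.inr (Or.inr hu), (Set.inter_eq_left.mpr (treeSupport_subset hu)).symm⟩
  | left c b ih =>
    rename_i a l r
    have hs' := treeSorted_mul.mp hs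
    rcases hu with rfl | hu | hu
    · refine ⟨_, mem_subtrees_self _, (Set.inter_eq_right.mpr ?_).symm⟩
      rw [treeSupport_mul, treeSupport_mul, c.treeSupport_eq]
      exact Set.union_subset_union_left _ Set.subset_union_right
    · obtain ⟨v, hv, he⟩ := ih hs'.1 hu
      refine ⟨v, Or.inr (Or.inl hv), ?_⟩
      rw [treeSupport_mul, Set.inter_union_distrib_left, ← he, Set.disjoint_iff_inter_eq_empty.mp
        (Set.disjoint_left.mpr fun x hx hx' => hs.disjoint (treeSupport_subset hv hx) hx'),
        Set.union_empty]
    · refine ⟨u, Or.inr (Or.inr hu), (Set.inter_eq_left.mpr ?_).symm⟩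
      rw [treeSupport_mul]
      exact (treeSupport_subset hu).trans Set.subset_union_right

/-- If every subtree of `s` that meets both `P` and `Q` contains `P`, then `s` can be cut into
a left part with support `P` and a right part with support `Q`. -/
theorem exists_leftCut {s : FreeMagma X} (hs : TreeSorted s) {P Q : Set X} (hP : P.Nonempty)
    (hQ : Q.Nonempty) (hPQ : ∀ x ∈ P, ∀ y ∈ Q, x < y) (hs' : treeSupport s = P ∪ Q)
    (h : ∀ u ∈ subtrees s, (treeSupport u ∩ P).Nonempty → (treeSupport u ∩ Q).Nonempty →
      P ⊆ treeSupport u) :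
    ∃ (l r : FreeMagma X) (_ : LeftCut s l r), treeSupport l = P ∧ treeSupport r = Q := by
  have hd : ∀ x ∈ P, x ∉ Q := fun x hx hx' => lt_irrefl x (hPQ x hx x hx')
  induction s using FreeMagma.rec generalizing Q with
  | of x =>
    rw [treeSupport_of] at hs'
    obtain ⟨p, hp⟩ := hP
    obtain ⟨q, hq⟩ := hQ
    have h₁ : p = x := hs'.superset (Or.inl hp)
    have h₂ : q = x := hs'.superset (Or.inr hq)
    exact absurd (hPQ p hp q hq) (by rw [h₁, h₂]; exact lt_irrefl _)
  | mul a b iha _ =>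
    have hs'' := treeSorted_mul.mp hs
    have hab : treeSupport a ∪ treeSupport b = P ∪ Q := by rw [← treeSupport_mul, hs']
    -- If `a` meets `Q`, it also meets `P`, hence contains `P`, and the cut is made inside `a` with
    -- `Q` replaced by its trace on `a`. If not, the cut at the root is the right one.
    by_cases haQ : (treeSupport a ∩ Q).Nonempty
    · obtain ⟨q, hqa, hq⟩ := haQ
      have haP : (treeSupport a ∩ P).Nonempty := by
        obtain ⟨p, hp⟩ := hP
        refine ⟨p, (hab.superset (Or.inl hp)).resolve_right fun hpb => ?_, hp⟩
        exact lt_asymm (hPQ p hp q hq) (hs''.2.2 q hqa p hpb)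
      have hPa := h a (Or.inr (Or.inl (mem_subtrees_self a))) haP ⟨q, hqa, hq⟩
      obtain ⟨l, r, c, hl, hr⟩ := iha (Q := treeSupport a ∩ Q) hs''.1 ⟨q, hqa, hq⟩
        (fun x hx y hy => hPQ x hx y hy.2)
        (by
          ext x
          constructor
          · intro hx
            exact (hab.subset (Or.inl hx)).imp_right fun hx' => ⟨hx, hx'⟩
          · rintro (hx | hx)
            · exact hPa hx
            · exact hx.1)
        (fun u hu h₁ h₂ => h u (Or.inr (Or.inl hu)) h₁
          (h₂.mono (Set.inter_subset_inter_right _ Set.inter_subset_right)))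
        (fun x hx hx' => hd x hx hx'.2)
      refine ⟨l, _, .left c b, hl, ?_⟩
      rw [treeSupport_mul, hr]
      ext x
      constructor
      · rintro (hx | hx)
        · exact hx.2
        · exact (hab.subset (Or.inr hx)).resolve_left fun hp => hs.disjoint (hPa hp) hx
      · intro hx
        exact (hab.superset (Or.inr hx)).imp_left fun hx' => ⟨hx', hx⟩
    · have haP : treeSupport a ⊆ P := fun x hx =>
        (hab.subset (Or.inl hx)).resolve_right fun hq => haQ ⟨x, hx, hq⟩
      have hQb : Q ⊆ treeSupport b := fun x hx =>
        (hab.superset (Or.inr hx)).resolve_left fun ha => haQ ⟨x, ha, hx⟩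
      -- A label of `P` in `b` would force all of `P` into `b`, and with it the labels of `a`.
      have hbP : ∀ x ∈ P, x ∉ treeSupport b := by
        intro x hx hxb
        obtain ⟨q, hq⟩ := hQ
        obtain ⟨y, hy⟩ := treeSupport_nonempty a
        exact hs.disjoint hy (h b (Or.inr (Or.inr (mem_subtrees_self b))) ⟨x, hxb, hx⟩
          ⟨q, hQb hq, hq⟩ (haP hy))
      refine ⟨a, b, .root a b, Set.Subset.antisymm haP fun x hx => ?_,
        Set.Subset.antisymm (fun x hx => ?_) hQb⟩
      · exact (hab.superset (Or.inl hx)).resolve_right (hbP x hx)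
      · exact (hab.subset (Or.inr hx)).resolve_left fun hp => hbP x hp hx

/-- There is a morphism `s ⟶ t` if every subtree of `s` that meets both halves of a subtree
`a □ b` of `t` contains `a`. -/
theorem nonempty_treeHom {s t : FreeMagma X} (hs : TreeSorted s) (ht : TreeSorted t)
    (hst : treeSupport s = treeSupport t)
    (h : ∀ a b, .mul a b ∈ subtrees t → ∀ u ∈ subtrees s,
      (treeSupport u ∩ treeSupport a).Nonempty → (treeSupport u ∩ treeSupport b).Nonempty →
      treeSupport a ⊆ treeSupport u) : Nonempty (TreeHom s t) := by
  induction t using FreeMagma.rec generalizing s with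
  | of x =>
    obtain rfl := hs.eq_of_support_subsingleton (hst.trans (treeSupport_of x))
    exact ⟨.mk (.id _)⟩
  | mul a b iha ihb =>
    have ht' := treeSorted_mul.mp ht
    obtain ⟨l, r, c, hl, hr⟩ := exists_leftCut hs (treeSupport_nonempty a)
      (treeSupport_nonempty b) ht'.2.2 (hst.trans (treeSupport_mul a b))
      (h a b (mem_subtrees_self _))
    have hlr := treeSorted_mul.mp (c.treeSorted hs)
    obtain ⟨f⟩ := iha hlr.1 ht'.1 hl fun a' b' hab u hu =>
      h a' b' (Or.inr (Or.inl hab)) u (subtrees_trans c.mem_subtrees hu)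
    -- A subtree `u` of the right part is the trace of a subtree `v` of `s`; the hypothesis applied
    -- to `v` is intersected with the support of `b`.
    obtain ⟨g⟩ := ihb hlr.2.1 ht'.2.1 hr fun a' b' hab u hu hua hub => by
      obtain ⟨v, hv, he⟩ := c.exists_subtree hs hu
      have hav := h a' b' (Or.inr (Or.inr hab)) v hv
        (hua.mono (Set.inter_subset_inter_left _ (he.subset.trans Set.inter_subset_left)))
        (hub.mono (Set.inter_subset_inter_left _ (he.subset.trans Set.inter_subset_left)))
      rw [he, hr]
      refine Set.subset_inter hav ?_
      refine Set.Subset.trans ?_ (treeSupport_subset hab)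
      rw [treeSupport_mul]
      exact Set.subset_union_left
    exact ⟨c.hom.comp (f.tensor g)⟩

/-- The only new support that a rotation creates is that of `b □ c`, a final segment of the rotated
node. That node and its ancestors change as trees but keep their supports, hence the two witnesses
`v` and `v'`. -/
theorem Rotation.exists_common_support {s t : FreeMagma X} (h : Rotation s t)
    (hs : TreeSorted s) {u : FreeMagma X} (hu : u ∈ subtrees t) :
    ∃ v ∈ subtrees s, ∃ v' ∈ subtrees t, treeSupport v = treeSupport v' ∧
      treeSupport u ⊆ treeSupport v ∧
      ∀ x ∈ treeSupport u, ∀ y ∈ treeSupport v, x ≤ y → y ∈ treeSupport u := by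
  have whole : ∀ {s t : FreeMagma X}, Rotation s t → treeSupport s = treeSupport t :=
    fun h => by rw [treeSupport, h.treeWord_eq]; rfl
  induction h with
  | η a b c =>
    have common : ∀ v ∈ subtrees (.mul (.mul a b) c), v ∈ subtrees (.mul a (.mul b c)) →
        ∃ w ∈ subtrees (.mul (.mul a b) c), ∃ w' ∈ subtrees (.mul a (.mul b c)),
          treeSupport w = treeSupport w' ∧ treeSupport v ⊆ treeSupport w ∧
          ∀ x ∈ treeSupport v, ∀ y ∈ treeSupport w, x ≤ y → y ∈ treeSupport v :=
      fun v hv hv' => ⟨v, hv, v, hv', rfl, subset_rfl, fun _ _ _ hy _ => hy⟩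
    have hw := whole (Rotation.η a b c)
    rcases hu with rfl | hu | rfl | hu | hu
    · exact ⟨_, mem_subtrees_self _, _, mem_subtrees_self _, hw, hw.superset,
        fun _ _ _ hy _ => hw.subset hy⟩
    · exact common u (Or.inr (Or.inl (Or.inr (Or.inl hu)))) (Or.inr (Or.inl hu))
    -- The new subtree `b □ c`: everything in the node that is not in `a`, and `a` comes before it.
    · refine ⟨_, mem_subtrees_self _, _, mem_subtrees_self _, hw, ?_, fun x hx y hy hxy => ?_⟩
      · rw [hw, treeSupport_mul a]
        exact Set.subset_union_right
      · rw [hw, treeSupport_mul] at hy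
        refine hy.resolve_left fun hya => ?_
        have hs' : TreeSorted (.mul a (.mul b c)) := by
          rw [TreeSorted, ← (Rotation.η a b c).treeWord_eq]
          exact hs
        exact ((treeSorted_mul.mp hs').2.2 y hya x hx).not_ge hxy
    · exact common u (Or.inr (Or.inl (Or.inr (Or.inr hu)))) (Or.inr (Or.inr (Or.inr (Or.inl hu))))
    · exact common u (Or.inr (Or.inr hu)) (Or.inr (Or.inr (Or.inr (Or.inr hu))))
  | left h b ih =>
    have hw := whole (Rotation.left h b)
    rcases hu with rfl | hu | hu
    · exact ⟨_, mem_subtrees_self _, _, mem_subtrees_self _, hw, hw.superset,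
        fun _ _ _ hy _ => hw.subset hy⟩
    · obtain ⟨v, hv, v', hv', hvu⟩ := ih (treeSorted_mul.mp hs).1 hu
      exact ⟨v, Or.inr (Or.inl hv), v', Or.inr (Or.inl hv'), hvu⟩
    · exact ⟨u, Or.inr (Or.inr hu), u, Or.inr (Or.inr hu), rfl, subset_rfl,
        fun _ _ _ hy _ => hy⟩
  | right a h ih =>
    have hw := whole (Rotation.right a h)
    rcases hu with rfl | hu | hu
    · exact ⟨_, mem_subtrees_self _, _, mem_subtrees_self _, hw, hw.superset,
        fun _ _ _ hy _ => hw.subset hy⟩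
    · exact ⟨u, Or.inr (Or.inl hu), u, Or.inr (Or.inl hu), rfl, subset_rfl,
        fun _ _ _ hy _ => hy⟩
    · obtain ⟨v, hv, v', hv', hvu⟩ := ih (treeSorted_mul.mp hs).2.1 hu
      exact ⟨v, Or.inr (Or.inr hv), v', Or.inr (Or.inr hv'), hvu⟩

end FreeDirected

end

section

open FreeDirected

/-! ### Right closures of parenthesized words -/

namespace ParenWord

variable {m : ℕ}

/-- The sets of letters which are the unions of the last few children of a node of the tree of
`S`, the trivial nodes included. -/
def rightClosure (S : ParenWord m) : Set (Set (Fin m)) :=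
  {I | (∃ p ∈ S.full, I ⊆ p ∧ ∀ x ∈ I, ∀ y ∈ p, x ≤ y → y ∈ I) ∧ ∀ q ∈ S.full, Compatible I q}

theorem compatible_of_mem_full (S : ParenWord m) {p q : Set (Fin m)} (hp : p ∈ S.full)
    (hq : q ∈ S.full) : Compatible p q := by
  rcases hp with hp | rfl | hp
  · rcases hq with hq | rfl | hq
    · exact S.nested p hp q hq
    · exact Or.inl (Set.subset_univ _)
    · exact .of_subsingleton hq p
  · exact Or.inr (Or.inl (Set.subset_univ _))
  · exact (Compatible.of_subsingleton hp q).symm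

theorem ordConnected_of_mem_full (S : ParenWord m) {p : Set (Fin m)} (hp : p ∈ S.full) :
    p.OrdConnected := by
  rcases hp with hp | rfl | hp
  · obtain ⟨a, b, rfl⟩ := S.isInterval p hp
    exact Set.ordConnected_Icc
  · exact Set.ordConnected_univ
  · rcases Set.Subsingleton.eq_empty_or_singleton hp with rfl | ⟨x, rfl⟩
    · exact Set.ordConnected_empty
    · exact Set.ordConnected_singleton

theorem full_subset_rightClosure (S : ParenWord m) : S.full ⊆ S.rightClosure :=
  fun p hp => ⟨⟨p, hp, subset_rfl, fun _ _ _ hy _ => hy⟩,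
    fun _ hq => S.compatible_of_mem_full hp hq⟩

theorem full_mono {S T : ParenWord m} (h : S ≤ T) : T.full ⊆ S.full :=
  fun _ hp => hp.imp_left fun hp => h hp

theorem singleton_mem_full (S : ParenWord m) (x : Fin m) : {x} ∈ S.full :=
  Or.inr (Or.inr Set.subsingleton_singleton)

theorem univ_mem_full (S : ParenWord m) : Set.univ ∈ S.full := Or.inr (Or.inl rfl)

/-- Let `I`, `J` be final segments of `p`, `q`. If `p ⊆ q`, compare `J` with `p`: if `J ⊆ p`, both
are final segments of `p` and hence nested; the cases `p ⊆ J` and `J` disjoint from `p` are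
immediate. Disjoint `p` and `q` are trivial. -/
theorem compatible_of_mem_rightClosure (S : ParenWord m) {I J : Set (Fin m)}
    (hI : I ∈ S.rightClosure) (hJ : J ∈ S.rightClosure) : Compatible I J := by
  have aux : ∀ {I J p q : Set (Fin m)}, I ⊆ p → (∀ x ∈ I, ∀ y ∈ p, x ≤ y → y ∈ I) →
      J ⊆ q → (∀ x ∈ J, ∀ y ∈ q, x ≤ y → y ∈ J) → p ⊆ q → Compatible J p →
      Compatible I J := by
    intro I J p q hIp hI hJq hJ hpq h
    rcases h with h | h | h
    · by_cases hc : J ⊆ I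
      · exact Or.inr (Or.inl hc)
      · obtain ⟨x, hxJ, hxI⟩ := Set.not_subset.mp hc
        refine Or.inl fun y hy => hJ x hxJ y (hpq (hIp hy)) (le_of_not_ge fun hle => hxI ?_)
        exact hI y hy x (h hxJ) hle
    · exact Or.inl (hIp.trans h)
    · exact Or.inr (Or.inr (h.symm.mono_left hIp))
  obtain ⟨⟨p, hp, hIp, hIu⟩, hIc⟩ := hI
  obtain ⟨⟨q, hq, hJq, hJu⟩, hJc⟩ := hJ
  rcases S.compatible_of_mem_full hp hq with h | h | h
  · exact aux hIp hIu hJq hJu h (hJc p hp)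
  · exact (aux hJq hJu hIp hIu h (hIc q hq)).symm
  · exact Or.inr (Or.inr (h.mono hIp hJq))

/-- Induction on the number of letters: split off the first child `J` of `I`, bracket `J` and `I \
J` separately, and join the two trees. Iterating this on the remainders is bracketing to the right.
-/
theorem exists_tree (S : ParenWord m) {I : Set (Fin m)} (hI : I ∈ S.rightClosure)
    (hne : I.Nonempty) : ∃ t : FreeMagma (Fin m), TreeSorted t ∧ treeSupport t = I ∧
      ∀ u ∈ subtrees t, treeSupport u ∈ S.rightClosure := by
  induction hn : I.ncard using Nat.strong_induction_on generalizing I with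
  | _ n ih =>
  obtain ⟨a, haI, ha⟩ := Set.exists_min_image I id I.toFinite hne
  by_cases hIa : I = {a}
  · refine ⟨.of a, List.pairwise_singleton _ _, (treeSupport_of a).trans hIa.symm, ?_⟩
    rintro _ rfl
    rwa [treeSupport_of, ← hIa]
  -- The first child is the largest node properly inside `I` that contains the least letter `a`; the
  -- trivial node `{a}` shows that there is a candidate.
  obtain ⟨J, ⟨hJ, haJ, hJI⟩, hmax⟩ := Set.exists_max_image
    {q | q ∈ S.full ∧ a ∈ q ∧ q ⊂ I} Set.ncard (Set.toFinite _)
    ⟨{a}, S.singleton_mem_full a, rfl, (Set.singleton_subset_iff.mpr haI).ssubset_of_ne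
      (Ne.symm hIa)⟩
  have hlt : ∀ x ∈ J, ∀ y ∈ I \ J, x < y := by
    intro x hx y hy
    refine lt_of_not_ge fun hle => hy.2 ?_
    exact (S.ordConnected_of_mem_full hJ).out haJ hx ⟨ha y hy.1, hle⟩
  have hK : I \ J ∈ S.rightClosure := by
    obtain ⟨⟨p, hp, hIp, hIu⟩, hIc⟩ := hI
    refine ⟨⟨p, hp, Set.sdiff_subset.trans hIp, fun x hx y hy hxy => ?_⟩, fun q hq => ?_⟩
    · exact ⟨hIu x hx.1 y hy hxy, fun hyJ => (hlt y hyJ x hx).not_ge hxy⟩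
    rcases hIc q hq with h | h | h
    · exact Or.inl (Set.sdiff_subset.trans h)
    · rcases S.compatible_of_mem_full hJ hq with h' | h' | h'
      · by_cases hqI : q = I
        · exact Or.inl (hqI ▸ Set.sdiff_subset)
        · refine Or.inr (Or.inr ?_)
          -- A node strictly inside `I` that contains `J` is `J`, by maximality.
          rw [← Set.eq_of_subset_of_ncard_le h' (hmax q ⟨hq, h' haJ, h.ssubset_of_ne hqI⟩)]
          exact Set.disjoint_sdiff_left
      · exact Or.inr (Or.inr (Set.disjoint_left.mpr fun x hx hxq => hx.2 (h' hxq)))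
      · exact Or.inr (Or.inl fun x hx => ⟨h hx, fun hxJ => Set.disjoint_left.mp h' hxJ hx⟩)
    · exact Or.inr (Or.inr (h.mono_left Set.sdiff_subset))
  obtain ⟨s, hs, hsJ, hsS⟩ := ih _ (hn ▸ Set.ncard_lt_ncard hJI) (S.full_subset_rightClosure hJ)
    ⟨a, haJ⟩ rfl
  obtain ⟨t, ht, htK, htS⟩ := ih _
    (hn ▸ Set.ncard_lt_ncard (Set.sdiff_subset.ssubset_of_ne fun h =>
      (h.superset haI).2 haJ)) hK (Set.nonempty_of_ssubset hJI) rfl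
  have hst : treeSupport (.mul s t) = I := by
    rw [treeSupport_mul, hsJ, htK, Set.union_sdiff_cancel hJI.subset]
  refine ⟨.mul s t, treeSorted_mul.mpr ⟨hs, ht, by rwa [hsJ, htK]⟩, hst, ?_⟩
  rintro u (rfl | hu | hu)
  · rwa [hst]
  · exact hsS u hu
  · exact htS u hu

/-- Final segments pull back along the monotone `blockIndex`, and a node inside a single block is
contained in, or disjoint from, any union of blocks. -/
theorem preimage_mem_rightClosure {n : ℕ} {k : Fin m → ℕ} {h : ∑ i, k i = n} {S : ParenWord m}
    {T : ∀ i, ParenWord (k i)} {I : Set (Fin m)} (hI : I ∈ S.rightClosure) :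
    blockIndex k h ⁻¹' I ∈ (subst k h S T).rightClosure := by
  obtain ⟨⟨p, hp, hIp, hIu⟩, hIc⟩ := hI
  refine ⟨⟨_, mem_full_subst.mpr (Or.inl ⟨p, hp, rfl⟩), Set.preimage_mono hIp,
    fun x hx y hy hxy => hIu _ hx _ hy (blockIndex_mono k h hxy)⟩, fun J hJ => ?_⟩
  rcases mem_full_subst.mp hJ with ⟨q, hq, rfl⟩ | ⟨i, q, _, rfl⟩
  · rcases hIc q hq with h' | h' | h'
    · exact Or.inl (Set.preimage_mono h')
    · exact Or.inr (Or.inl (Set.preimage_mono h'))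
    · exact Or.inr (Or.inr (h'.preimage _))
  · exact Or.inr ((graft_nested_aux I i q).imp_right fun hd => hd.symm)

theorem image_mem_rightClosure {n : ℕ} {k : Fin m → ℕ} {h : ∑ i, k i = n} {S : ParenWord m}
    {T : ∀ i, ParenWord (k i)} {i : Fin m} {I : Set (Fin (k i))}
    (hI : I ∈ (T i).rightClosure) :
    (fun j => blockEquiv k h ⟨i, j⟩) '' I ∈ (subst k h S T).rightClosure := by
  obtain ⟨⟨p, hp, hIp, hIu⟩, hIc⟩ := hI
  refine ⟨⟨_, mem_full_subst.mpr (Or.inr ⟨i, p, hp, rfl⟩), Set.image_mono hIp, ?_⟩,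
    fun J hJ => ?_⟩
  · rintro _ ⟨x, hx, rfl⟩ _ ⟨y, hy, rfl⟩ hxy
    exact ⟨y, hIu x hx y hy ((blockEquiv_strictMono k h i).le_iff_le.mp hxy), rfl⟩
  rcases mem_full_subst.mp hJ with ⟨q, hq, rfl⟩ | ⟨i', q, hq, rfl⟩
  · exact (graft_nested_aux q i I).imp_right Or.inr
  · by_cases hi : i = i'
    · subst hi
      rcases hIc q hq with h' | h' | h'
      · exact Or.inl (Set.image_mono h')
      · exact Or.inr (Or.inl (Set.image_mono h'))
      · exact Or.inr (Or.inr
          (Set.disjoint_image_iff (blockEquiv_strictMono k h i).injective |>.mpr h'))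
    · refine Or.inr (Or.inr (Set.disjoint_left.mpr ?_))
      rintro _ ⟨x, _, rfl⟩ ⟨y, _, hxy⟩
      have := congrArg (blockIndex k h) hxy
      simp only [blockIndex_blockEquiv] at this
      exact hi this.symm

end ParenWord

/-! ### The right-bracketed object of a parenthesized word -/

namespace FreeDirected

/-- The subtrees of an object. -/
def objSubtrees {X : Type u} : FreeDirected X → Set (FreeMagma X)
  | zero => ∅
  | tree t => subtrees t

/-- Each subtree after substitution lies in a substituted object or sits over a subtree of `A`. A
node of `A` with a factor that evaluates to `0` collapses onto its other factor and contributes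
nothing new. -/
theorem mem_objSubtrees_evalObj {X : Type u} {Y : Type u} (V : X → FreeDirected Y)
    (A : FreeDirected X) {u : FreeMagma Y} (hu : u ∈ objSubtrees (evalObj V A)) :
    (∃ x, u ∈ objSubtrees (V x)) ∨
      ∃ v ∈ objSubtrees A, treeSupport u = {y | ∃ x ∈ treeSupport v, y ∈ (V x).word} := by
  rcases A with _ | t
  · exact hu.elim
  change u ∈ objSubtrees (evalTree V t) at hu
  induction t using FreeMagma.rec with
  | of x => exact Or.inl ⟨x, hu⟩
  | mul a b iha ihb =>
    have hword := word_evalObj V (tree (.mul a b))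
    change word (DirectedMonoidal.tensorObj (evalTree V a) (evalTree V b)) = _ at hword
    change u ∈ objSubtrees (DirectedMonoidal.tensorObj (evalTree V a) (evalTree V b)) at hu
    -- With both factors arbitrary objects, case distinction on `0` makes the strict product
    -- compute.
    generalize evalTree V a = A at *
    generalize evalTree V b = B at *
    rcases A with _ | a'
    · exact (ihb hu).imp_right fun ⟨v, hv, he⟩ => ⟨v, Or.inr (Or.inr hv), he⟩
    rcases B with _ | b'
    · exact (iha hu).imp_right fun ⟨v, hv, he⟩ => ⟨v, Or.inr (Or.inl hv), he⟩
    rcases hu with rfl | hu | hu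
    · refine Or.inr ⟨_, mem_subtrees_self _, ?_⟩
      ext y
      change y ∈ word (tree (.mul a' b')) ↔ _
      change word (tree (.mul a' b')) = _ at hword
      rw [hword, List.mem_flatMap]
      rfl
    · exact (iha hu).imp_right fun ⟨v, hv, he⟩ => ⟨v, Or.inr (Or.inl hv), he⟩
    · exact (ihb hu).imp_right fun ⟨v, hv, he⟩ => ⟨v, Or.inr (Or.inr hv), he⟩

end FreeDirected

namespace ParenWord

variable {m : ℕ}

/-- `A` is obtained from the word `S` by bracketing to the right inside all parentheses. -/
def IsRightBracketing (S : ParenWord m) (A : FreeDirected (Fin m)) : Prop :=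
  A.word = List.finRange m ∧ ∀ u ∈ objSubtrees A, treeSupport u ∈ S.rightClosure

theorem treeSorted_of_treeWord_eq {t : FreeMagma (Fin m)} (h : treeWord t = List.finRange m) :
    TreeSorted t := by
  rw [TreeSorted, h]
  exact (List.sortedLT_finRange m).pairwise

theorem treeSupport_of_treeWord_eq {t : FreeMagma (Fin m)} (h : treeWord t = List.finRange m) :
    treeSupport t = Set.univ := by
  ext x
  simp [treeSupport, h]

/-- The supports of both objects lie in one pairwise compatible family. Uniqueness turns every later
identity of objects into a check of the defining property. -/
theorem IsRightBracketing.unique {S : ParenWord m} {A B : FreeDirected (Fin m)}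
    (hA : S.IsRightBracketing A) (hB : S.IsRightBracketing B) : A = B := by
  obtain ⟨hA, hA'⟩ := hA
  obtain ⟨hB, hB'⟩ := hB
  rcases A with _ | s <;> rcases B with _ | t
  · rfl
  · exact absurd (hB.trans hA.symm) (treeWord_ne_nil t)
  · exact absurd (hA.trans hB.symm) (treeWord_ne_nil s)
  · exact congrArg tree (eq_of_compatible (treeSorted_of_treeWord_eq hA)
      (treeSorted_of_treeWord_eq hB)
      ((treeSupport_of_treeWord_eq hA).trans (treeSupport_of_treeWord_eq hB).symm)
      fun u hu v hv => S.compatible_of_mem_rightClosure (hA' u hu) (hB' v hv))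

theorem exists_isRightBracketing (S : ParenWord m) : ∃ A, S.IsRightBracketing A := by
  rcases Set.eq_empty_or_nonempty (Set.univ : Set (Fin m)) with h | h
  · have : m = 0 := Nat.eq_zero_of_not_pos fun h₀ =>
      (Set.univ_eq_empty_iff.mp h).false ⟨0, h₀⟩
    subst this
    exact ⟨zero, rfl, fun _ hu => hu.elim⟩
  · obtain ⟨t, ht, htu, htS⟩ := S.exists_tree (S.full_subset_rightClosure S.univ_mem_full) h
    refine ⟨tree t, ?_, htS⟩
    refine List.Perm.eq_of_pairwise' (r := (· < ·)) ht (List.sortedLT_finRange m).pairwise ?_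
    refine (List.perm_ext_iff_of_nodup (ht.imp fun hlt => ne_of_lt hlt)
      (List.nodup_finRange m)).mpr fun x => iff_of_true ?_ (List.mem_finRange x)
    exact htu.superset (Set.mem_univ x)

/-- The right-bracketed object of a parenthesized word. -/
noncomputable def rightBracketing (S : ParenWord m) : LaPlaza m :=
  ⟨S.exists_isRightBracketing.choose, S.exists_isRightBracketing.choose_spec.1⟩

theorem isRightBracketing_rightBracketing (S : ParenWord m) :
    S.IsRightBracketing S.rightBracketing.obj :=
  S.exists_isRightBracketing.choose_spec

theorem IsRightBracketing.eq {S : ParenWord m} {A : LaPlaza m}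
    (h : S.IsRightBracketing A.obj) : S.rightBracketing = A :=
  ObjectProperty.FullSubcategory.ext (S.isRightBracketing_rightBracketing.unique h)

/-- For a subtree `a □ b` of the target, `a` is a final segment of a node `p` of `T`, which is also
a node of `S`. A subtree `u` of the source that meets `a` and `b` meets `p` and leaves it, so being
compatible with `p` it contains `p`, and hence `a`: this is the criterion of `nonempty_treeHom`. -/
theorem nonempty_hom_rightBracketing {S T : ParenWord m} (hST : S ≤ T) :
    Nonempty (S.rightBracketing ⟶ T.rightBracketing) := by
  obtain ⟨hA, hA'⟩ := S.isRightBracketing_rightBracketing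
  obtain ⟨hB, hB'⟩ := T.isRightBracketing_rightBracketing
  suffices Nonempty (S.rightBracketing.obj ⟶ T.rightBracketing.obj) from
    this.map ObjectProperty.homMk
  generalize S.rightBracketing.obj = A at *
  generalize T.rightBracketing.obj = B at *
  rcases A with _ | s <;> rcases B with _ | t
  · exact ⟨𝟙 _⟩
  · exact absurd (hB.trans hA.symm) (treeWord_ne_nil t)
  · exact absurd (hA.trans hB.symm) (treeWord_ne_nil s)
  refine (nonempty_treeHom (treeSorted_of_treeWord_eq hA) (treeSorted_of_treeWord_eq hB)
    ((treeSupport_of_treeWord_eq hA).trans (treeSupport_of_treeWord_eq hB).symm)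
    fun a b hab u hu => ?_).map Hom.tree
  rintro ⟨x, hxu, hxa⟩ ⟨y, hyu, hyb⟩
  obtain ⟨⟨p, hp, hap, hau⟩, _⟩ :=
    hB' a (subtrees_trans hab (Or.inr (Or.inl (mem_subtrees_self a))))
  have hsort := (treeSorted_of_treeWord_eq hB).subtree hab
  -- The letter `y` comes after `x ∈ a`; inside `p` it would belong to the final segment `a`.
  have hyp : y ∉ p := fun hyp => hsort.disjoint
    (hau x hxa y hyp ((treeSorted_mul.mp hsort).2.2 x hxa y hyb).le) hyb
  exact hap.trans (((hA' u hu).2 p (full_mono hST hp)).symm.subset_of_mem (hap hxa) hxu hyu hyp)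

/-- The subtrees of the composite are single letters, copies of subtrees of the `B i`, and subtrees
lying over subtrees of `A`; the supports of the last two kinds are an image and a preimage of a
right-closed set. With uniqueness this is strict compatibility with composition, empty words
included. -/
theorem isRightBracketing_substObj {n : ℕ} (k : Fin m → ℕ) (h : ∑ i, k i = n)
    {S : ParenWord m} {T : ∀ i, ParenWord (k i)} {A : FreeDirected (Fin m)}
    {B : ∀ i, FreeDirected (Fin (k i))} (hA : S.IsRightBracketing A)
    (hB : ∀ i, (T i).IsRightBracketing (B i)) :
    (subst k h S T).IsRightBracketing (LaPlaza.substObj k h A B) := by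
  refine ⟨LaPlaza.word_substObj k h hA.1 fun i => (hB i).1, fun u hu => ?_⟩
  rcases mem_objSubtrees_evalObj _ _ hu with ⟨i, hu⟩ | ⟨v, hv, he⟩
  · rcases mem_objSubtrees_evalObj _ _ hu with ⟨j, hu⟩ | ⟨v, hv, he⟩
    · obtain rfl : u = .of (blockEquiv k h ⟨i, j⟩) := hu
      rw [treeSupport_of]
      exact full_subset_rightClosure _ (singleton_mem_full _ _)
    · convert image_mem_rightClosure (h := h) (S := S) ((hB i).2 v hv) using 1
      rw [he]
      ext y
      refine exists_congr fun j => and_congr_right fun _ => ?_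
      change y ∈ [blockEquiv k h ⟨i, j⟩] ↔ _
      rw [List.mem_singleton, eq_comm]
  · convert preimage_mem_rightClosure (h := h) (T := T) (hA.2 v hv) using 1
    rw [he]
    ext y
    obtain ⟨⟨i, j⟩, rfl⟩ := (blockEquiv k h).surjective y
    simp only [Set.mem_ofPred_eq, Set.mem_preimage, blockIndex_blockEquiv, word_evalObj,
      (hB _).1, List.mem_flatMap, List.mem_finRange, true_and]
    have hgen : ∀ i' j', blockEquiv k h ⟨i, j⟩ ∈ (LaPlaza.blockGen k h i' j').word ↔
        (⟨i, j⟩ : Σ i, Fin (k i)) = ⟨i', j'⟩ := by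
      intro i' j'
      change _ ∈ [blockEquiv k h ⟨i', j'⟩] ↔ _
      rw [List.mem_singleton, (blockEquiv k h).apply_eq_iff_eq]
    constructor
    · rintro ⟨i', hi', j', hj'⟩
      cases (hgen i' j').mp hj'
      exact hi'
    · exact fun hi => ⟨i, hi, j, (hgen i j).mpr rfl⟩

/-! ### The parenthesized word of an object -/

/-- The parenthesized word formed by all the parentheses of an object. -/
def ofObj (A : LaPlaza m) : ParenWord m where
  parens := {I | (∃ u ∈ objSubtrees A.obj, treeSupport u = I) ∧ I.Nontrivial ∧ I ≠ Set.univ}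
  isInterval := by
    obtain ⟨_ | t, hA⟩ := A
    · rintro _ ⟨⟨_, hu, _⟩, _⟩
      exact hu.elim
    · rintro _ ⟨⟨u, hu, rfl⟩, hn, _⟩
      refine exists_eq_Icc hn ⟨fun x hx y hy z hz => ?_⟩
      refine (treeSorted_of_treeWord_eq hA).mem_of_le_of_le hu hx hy ?_ hz.1 hz.2
      exact (treeSupport_of_treeWord_eq hA).superset (Set.mem_univ z)
  nontrivial _ hI := hI.2.1
  ne_univ _ hI := hI.2.2
  nested := by
    obtain ⟨_ | t, hA⟩ := A
    · rintro _ ⟨⟨_, hu, _⟩, _⟩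
      exact hu.elim
    · rintro _ ⟨⟨u, hu, rfl⟩, _⟩ _ ⟨⟨v, hv, rfl⟩, _⟩
      exact (treeSorted_of_treeWord_eq hA).compatible hu hv

theorem treeSupport_mem_full_ofObj {A : LaPlaza m} {u : FreeMagma (Fin m)}
    (hu : u ∈ objSubtrees A.obj) : treeSupport u ∈ (ofObj A).full := by
  by_cases h₁ : (treeSupport u).Nontrivial
  · by_cases h₂ : treeSupport u = Set.univ
    · exact Or.inr (Or.inl h₂)
    · exact Or.inl ⟨⟨u, hu, rfl⟩, h₁, h₂⟩
  · exact Or.inr (Or.inr (Set.not_nontrivial_iff.mp h₁))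

/-- When all parentheses of a binary tree are kept, nothing is left to bracket. This is surjectivity
on objects. -/
theorem rightBracketing_ofObj (A : LaPlaza m) : (ofObj A).rightBracketing = A :=
  IsRightBracketing.eq ⟨A.property, fun _ hu =>
    full_subset_rightClosure _ (treeSupport_mem_full_ofObj hu)⟩

/-- The parentheses which two words have in common. -/
def common (S T : ParenWord m) : ParenWord m where
  parens := S.parens ∩ T.parens
  isInterval p hp := S.isInterval p hp.1
  nontrivial p hp := S.nontrivial p hp.1
  ne_univ p hp := S.ne_univ p hp.1
  nested p hp q hq := S.nested p hp.1 q hq.1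

theorem le_common_left (S T : ParenWord m) : S ≤ common S T :=
  fun _ hp => hp.1

theorem le_common_right (S T : ParenWord m) : T ≤ common S T :=
  fun _ hp => hp.2

theorem mem_full_common {S T : ParenWord m} {p : Set (Fin m)} (hS : p ∈ S.full)
    (hT : p ∈ T.full) : p ∈ (common S T).full := by
  rcases hS with hS | hS
  · rcases hT with hT | hT
    · exact Or.inl ⟨hS, hT⟩
    · exact Or.inr hT
  · exact Or.inr hS

/-- By `Rotation.exists_common_support`, each support in `t` is a final segment of a node common to
`s` and `t`; it is compatible with all common nodes because these are nodes of `t`. -/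
theorem rightBracketing_common {s t : FreeMagma (Fin m)} (h : Rotation s t)
    (hs : treeWord s = List.finRange m) (ht : treeWord t = List.finRange m) :
    (common (ofObj ⟨tree s, hs⟩) (ofObj ⟨tree t, ht⟩)).rightBracketing = ⟨tree t, ht⟩ := by
  refine IsRightBracketing.eq ⟨ht, fun u hu => ⟨?_, fun q hq => ?_⟩⟩
  · obtain ⟨v, hv, v', hv', he, hvu⟩ :=
      h.exists_common_support (treeSorted_of_treeWord_eq hs) hu
    exact ⟨_, mem_full_common (treeSupport_mem_full_ofObj hv)
      (he ▸ treeSupport_mem_full_ofObj hv'), hvu⟩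
  · exact compatible_of_mem_full _ (treeSupport_mem_full_ofObj hu)
      (full_mono (le_common_right _ _) hq)

end ParenWord

end

section

open FreeDirected

/-! ### The map of operads -/

/-- Bracketing to the right, as a map from the associahedral operad to the LaPlaza operad. -/
noncomputable def rightBracketingHom : associahedralOperad.Hom laPlazaOperad where
  app m :=
    { obj := fun S : ParenWord m => S.rightBracketing
      -- The choice is immaterial, since hom-sets in `LaPlaza m` have at most one element.
      map := fun f => (ParenWord.nonempty_hom_rightBracketing (leOfHom f)).some
      map_id := fun _ => Subsingleton.elim (α := (_ : LaPlaza m) ⟶ _) _ _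
      map_comp := fun _ _ => Subsingleton.elim (α := (_ : LaPlaza m) ⟶ _) _ _ }
  app_one := by
    refine ParenWord.IsRightBracketing.eq (S := ParenWord.bare 1) (A := ⟨of 0, rfl⟩) ⟨rfl, ?_⟩
    rintro _ rfl
    rw [treeSupport_of]
    exact ParenWord.full_subset_rightClosure _ (ParenWord.singleton_mem_full _ _)
  app_γ_obj k h S T := ParenWord.IsRightBracketing.eq (ParenWord.isRightBracketing_substObj k h
    (ParenWord.isRightBracketing_rightBracketing S)
    fun i => ParenWord.isRightBracketing_rightBracketing (T i))
  app_γ_map {m n} k h S S' T T' f g := by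
    have ho : ∀ (S : ParenWord m) (T : ∀ i, ParenWord (k i)),
        (ParenWord.subst k h S T).rightBracketing = (laPlazaOperad.γ k h).obj
          (S.rightBracketing, fun i => (T i).rightBracketing) := fun S T =>
      ParenWord.IsRightBracketing.eq (ParenWord.isRightBracketing_substObj k h
        (ParenWord.isRightBracketing_rightBracketing S)
        fun i => ParenWord.isRightBracketing_rightBracketing (T i))
    exact @Subsingleton.helim _ _ (LaPlaza.subsingleton_hom (m := n) _ _) (congrArg₂ (fun A B : laPlazaOperad.Op n => (A ⟶ B))
      (ho S T) (ho S' T')) _ _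

/-- Each rotation lies in the image, rotations connect the source of any morphism to its target, and
by coherence the morphism equals the resulting composite. -/
theorem rightBracketingHom_isSurjection : rightBracketingHom.IsSurjection := by
  intro m
  refine ⟨fun A => ⟨ParenWord.ofObj A, ParenWord.rightBracketing_ofObj A⟩, ?_⟩
  let W := ((⊤ : MorphismProperty (associahedralOperad.Op m)).strictMap
    (rightBracketingHom.app m))
  have thin : ∀ {A B : LaPlaza m} (f g : A ⟶ B), f = g := fun f g => Subsingleton.elim f g
  have rotation : ∀ {s t : FreeMagma (Fin m)} (_ : Rotation s t)
      (hs : treeWord s = List.finRange m) (ht : treeWord t = List.finRange m),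
      ∃ f : (⟨tree s, hs⟩ : LaPlaza m) ⟶ ⟨tree t, ht⟩, W f := by
    intro s t h hs ht
    have hm := MorphismProperty.map_mem_strictMap (⊤ : MorphismProperty (ParenWord m))
      (rightBracketingHom.app m)
      (homOfLE (ParenWord.le_common_left (ParenWord.ofObj ⟨tree s, hs⟩)
        (ParenWord.ofObj ⟨tree t, ht⟩))) trivial
    -- The image morphism has endpoints only propositionally equal to `s` and `t`; this transports
    -- it.
    have key : ∀ {A B A' B' : LaPlaza m} (f : A ⟶ B), A = A' → B = B' → W f →
        ∃ f' : A' ⟶ B', W f' := by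
      rintro A B _ _ f rfl rfl hf
      exact ⟨f, hf⟩
    exact key _ (ParenWord.rightBracketing_ofObj _) (ParenWord.rightBracketing_common h hs ht) hm
  have rotations : ∀ {s t : FreeMagma (Fin m)} (_ : Relation.ReflTransGen Rotation s t)
      (hs : treeWord s = List.finRange m) (ht : treeWord t = List.finRange m),
      ∃ f : (⟨tree s, hs⟩ : LaPlaza m) ⟶ ⟨tree t, ht⟩, W.multiplicativeClosure f := by
    intro s t h hs
    induction h with
    | refl => exact fun _ => ⟨𝟙 _, .id _⟩
    | tail _ h ih =>
      intro ht
      -- Rotations preserve words, so the intermediate trees are objects of `LaPlaza m` too.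
      obtain ⟨f, hf⟩ := ih (h.treeWord_eq.trans ht)
      obtain ⟨g, hg⟩ := rotation h (h.treeWord_eq.trans ht) ht
      exact ⟨f ≫ g, .comp_of f g hf hg⟩
  suffices ∀ {A B : LaPlaza m} (f : A ⟶ B), W.multiplicativeClosure f from
    eq_top_iff.mpr fun A B f _ => this f
  intro A B f
  obtain ⟨A, hA⟩ := A
  obtain ⟨B, hB⟩ := B
  obtain ⟨e, he⟩ : ∃ e : A ⟶ B, e = f.hom := ⟨_, rfl⟩
  rcases e with _ | e
  · rw [thin f (𝟙 _)]
    exact .id _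
  · induction e using TreeHom.ind with | _ e
    obtain ⟨g, hg⟩ := rotations (reflTransGen_rotation e) hA hB
    rwa [thin f g]

/-! ### The value on the generating associator -/

theorem rightBracketing_leftThree : ParenWord.leftThree.rightBracketing =
    ⟨DirectedMonoidal.tensorObj (DirectedMonoidal.tensorObj (of 0) (of 1)) (of 2), rfl⟩ := by
  refine ParenWord.IsRightBracketing.eq ⟨rfl, ?_⟩
  rintro u (rfl | (rfl | rfl | rfl) | rfl)
  all_goals apply ParenWord.full_subset_rightClosure
  · rw [ParenWord.treeSupport_of_treeWord_eq rfl]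
    exact ParenWord.univ_mem_full _
  · refine Or.inl (Set.mem_singleton_iff.mpr ?_)
    ext x
    rw [treeSupport_mul, treeSupport_of, treeSupport_of]
    fin_cases x <;> simp
  all_goals
    rw [treeSupport_of]
    exact ParenWord.singleton_mem_full _ _

theorem rightBracketing_bare_three : (ParenWord.bare 3).rightBracketing =
    ⟨DirectedMonoidal.tensorObj (of 0) (DirectedMonoidal.tensorObj (of 1) (of 2)), rfl⟩ := by
  refine ParenWord.IsRightBracketing.eq ⟨rfl, ?_⟩
  rintro u (rfl | rfl | rfl | rfl | rfl)
  · apply ParenWord.full_subset_rightClosure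
    rw [ParenWord.treeSupport_of_treeWord_eq rfl]
    exact ParenWord.univ_mem_full _
  · apply ParenWord.full_subset_rightClosure
    rw [treeSupport_of]
    exact ParenWord.singleton_mem_full _ _
  -- The subtree `x₂ □ x₃` is not a node of the bare word, only a final segment of the root.
  · refine ⟨⟨Set.univ, ParenWord.univ_mem_full _, Set.subset_univ _, ?_⟩, ?_⟩
    · intro x hx y _ hxy
      rw [treeSupport_mul, treeSupport_of, treeSupport_of] at hx ⊢
      fin_cases x <;> fin_cases y <;> simp at hx hxy ⊢
    · rintro q (hq | rfl | hq)
      · exact hq.elim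
      · exact Or.inl (Set.subset_univ _)
      · exact Compatible.of_subsingleton hq _
  all_goals
    apply ParenWord.full_subset_rightClosure
    rw [treeSupport_of]
    exact ParenWord.singleton_mem_full _ _

end

theorem mainTheorem5 :
    ∃ Λ : associahedralOperad.Hom laPlazaOperad,
      Λ.IsSurjection ∧
        Arrow.mk ((Λ.app 3).map associahedralArrow) = Arrow.mk laPlazaArrow := by
  refine ⟨rightBracketingHom, rightBracketingHom_isSurjection, ?_⟩
  -- By coherence, arrows with the same endpoints are equal, so only source and target need
  -- comparing.
  have key : ∀ {A B A' B' : LaPlaza 3} (f : A ⟶ B) (f' : A' ⟶ B'), A = A' → B = B' →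
      Arrow.mk f = Arrow.mk f' := by
    rintro A B _ _ f f' rfl rfl
    rw [Subsingleton.elim f f']
  exact key _ _ rightBracketing_leftThree rightBracketing_bare_three
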